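/- **Setting.** Let $Q=\pi_{\mathbf y}(R_1(e_1)\Join\cdots\Join R_n(e_n))$ be a conjunctive query without self-joins, $\mathcal V=\bigcup_i e_i$, $\mathbf y\subseteq\mathcal V$, and let $\mathcal T$ be a free-connex join tree of $Q$ with root $r$, that is, a finite rooted tree whose nodes are labelled by attribute sets (a node is written as its attribute set $e$, its parent is $p_e$, and $\mathsf{key}(e)=e\cap p_e$, $\mathsf{key}(r)=\emptyset$) such that: each $R_i$ corresponds to a distinct node with attribute set $e_i$, the other nodes being called generalized; every leaf corresponds to some $R_i$; for each attribute the nodes containing it form a connected set; a generalized node is contained in each of its children; no node of an $R_i$ is an ancestor of a generalized node; and there is a connected set $\mathcal E_{\mathsf{con}}$ of nodes with $r\in\mathcal E_{\mathsf{con}}$, $\mathsf{key}(e)\subseteq\mathbf y$ for all $e\in\mathcal E_{\mathsf{con}}$, and $\mathbf y\subseteq\bigcup_{e\in\mathcal E_{\mathsf{con}}}e$. $\mathcal T_e$ is the subtree rooted at $e$. For a database $D$, let $V_s(R_e)$ be the set of tuples over $e$ that belong to $R_e$ (if $e$ is not generalized) and whose projection to $\mathsf{key}(c)$ lies in $V_p(R_c):=\pi_{\mathsf{key}(c)}V_s(R_c)$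 for each child $c$ of $e$; let $V_l(R_e):=\pi_{\mathbf y\cap e}Q(D)$ (the live view). An update inserts a tuple $t$ into, or deletes it from, one relation. For a view $X$ put $\Delta X:=X(D+t)\setminus X(D)$ for an insertion and $\Delta X:=X(D)\setminus X(D-t)$ for a deletion; in particular this defines $\Delta Q(D,t)$. Let $\hat D=D+t$ for an insertion and $\hat D=D$ for a deletion. A *witness* of the update is a tuple $t'$ over $\mathbf y\cap e$ at a node $e\in\mathcal E_{\mathsf{con}}$ with $t'\in\Delta(\pi_{\mathbf y\cap e}V_s(R_e))$ such that $e=r$, or $t'[\mathsf{key}(e)]\notin\Delta V_p(R_e)$ and $t'[\mathsf{key}(e)]\in\pi_{\mathsf{key}(e)}V_l(R_{p_e})$, the live view being that of $D$, before the update. $Q(\hat D\ltimes t')$ is the set of the results in $Q(\hat D)$ that come from tuples of the join agreeing with $t'$ on $\mathbf y\cap e$. **Algorithms.** $\textsc{FullEnum}(\mathcal T_e,e,t)$ yields the empty tuple if $e\notin\mathcal E_{\mathsf{con}}$; otherwise it loops over the $t_0\in\pi_{\mathbf y\cap e}V_s(R_e)$ with $t_0[\mathsf{key}(e)]=t$ and,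 in nested loops over the children $c$ of $e$, over the results of $\textsc{FullEnum}(\mathcal T_c,c,t_0[\mathsf{key}(c)])$, and yields the combined tuples. $\textsc{DeltaEnum}$ loops over the stored list of witnesses; for a witness $t'$ at $e_i$, with path $e_i,e_{i+1},\dots,e_k=r$ to the root, it loops over $q\in t'\Join V_l(R_{e_{i+1}})\Join\cdots\Join V_l(R_{e_k})$ and, for each $q$, by nested loops, yields all combinations of the results of $\textsc{FullEnum}$ on $\mathcal T_{e_i}$ and on $\mathcal T_{e_j}-\mathcal T_{e_{j-1}}$, $i<j\le k$, where the tuple at $e_j$, $i\le j\le k$, is fixed to $q[\mathbf y\cap e_j]$. It runs on the following memory: the list of witnesses and, for every non-root $e\in\mathcal E_{\mathsf{con}}$, hash indexes with key $\mathsf{key}(e)$ on $\pi_{\mathbf y\cap e}V_s(R_e)$ (for $\hat D$) and on $V_l(R_{p_e})$ (for $D$), each bucket being a list without repetitions, in any order. One step is a hash lookup, an advance of a list cursor (with loading the tuple), or an output. **Lemma.** For every such $Q,\mathcal T,\mathcal E_{\mathsf{con}}$ there is a constant $c$ such that for every domain of values, every database $D$ and every update: 1. $\Delta Q(D,t)=\biguplus_{t'\text{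 a witness}}Q(\hat D\ltimes t')$, a disjoint union; 2. $\textsc{DeltaEnum}$ outputs every tuple of $\Delta Q(D,t)$ exactly once, outputs nothing else, and halts; the number of steps from the start to the first output, between any two consecutive outputs, and from the last output to the halt (from the start to the halt, if there is no output) is at most $c$. -/

import Mathlib

/-- A conjunctive query `π_y (⋈ i, R_i (e_i))` without self-joins: `V` is the set of all
attributes, `I` names the input relations, `att i` is the attribute set `e_i` of `R_i` and `out`
is the set `y` of output attributes. -/
structure CQ (V I : Type*) where
  att : I → Finset V
  out : Finset V
  cover : ∀ x : V, ∃ i, x ∈ att i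

/-- A tuple over the attribute set `s`. -/
abbrev Tup {V : Type*} (Dom : Type*) (s : Finset V) : Type _ := {x // x ∈ s} → Dom

/-- The projection `t[s]` of a tuple `t`. -/
def Tup.proj {V Dom : Type*} {s t : Finset V} (h : s ⊆ t) (u : Tup Dom t) : Tup Dom s :=
  fun x => u ⟨x.1, h x.2⟩

/-- The projection to `s` of a tuple over the set `V` of all attributes. -/
def restr {V Dom : Type*} (s : Finset V) (a : V → Dom) : Tup Dom s := fun x => a x.1

/-- A database: one finite relation (a set, no multiplicities) for every relation name. -/
abbrev Database {V I : Type*} (Q : CQ V I) (Dom : Type*) : Type _ :=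
  ∀ i, Finset (Tup Dom (Q.att i))

/-- The result `Q(D)`: projections to `y` of the tuples of the natural join. -/
def CQ.eval {V I Dom : Type*} (Q : CQ V I) (D : Database Q Dom) : Set (Tup Dom Q.out) :=
  {q | ∃ a : V → Dom, (∀ i, restr (Q.att i) a ∈ D i) ∧ q = restr Q.out a}

/-! ### Updates and deltas -/

inductive UpdateKind
  | ins
  | del

/-- A single-tuple update: insert `tup` into, or delete it from, the relation `rel`. -/
structure Update {V I : Type*} (Q : CQ V I) (Dom : Type*) where
  kind : UpdateKind
  rel : I
  tup : Tup Dom (Q.att rel)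

namespace Update

variable {V I Dom : Type*} {Q : CQ V I}

open scoped Classical in
/-- `D + t`. -/
noncomputable def plus (U : Update Q Dom) (D : Database Q Dom) : Database Q Dom :=
  Function.update D U.rel (insert U.tup (D U.rel))

open scoped Classical in
/-- `D - t`. -/
noncomputable def minus (U : Update Q Dom) (D : Database Q Dom) : Database Q Dom :=
  Function.update D U.rel ((D U.rel).erase U.tup)

/-- The delta of a view `X`: `X(D+t) - X(D)` for an insertion, `X(D) - X(D-t)` for a deletion. -/
def delta {α : Type*} (U : Update Q Dom) (X : Database Q Dom → Set α) (D : Database Q Dom) :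
    Set α :=
  match U.kind with
  | .ins => X (U.plus D) \ X D
  | .del => X D \ X (U.minus D)

/-- The database on which the delta is enumerated: after the insertion of the tuple, respectively
before its deletion. -/
noncomputable def enumDB (U : Update Q Dom) (D : Database Q Dom) : Database Q Dom :=
  match U.kind with
  | .ins => U.plus D
  | .del => D

end Update

/-! ### Free-connex join trees -/

/-- A set of nodes of a rooted tree (ordered by ancestorship, the root is `⊥`) is connected if it
contains the path between any two of its nodes; the path from `a` to `b` consists of the nodes
between the lowest common ancestor `a ⊓ b` and `a`, or between `a ⊓ b` and `b`. -/
def TreeConnected {T : RootedTree} (X : Set T) : Prop :=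
  ∀ a ∈ X, ∀ b ∈ X, ∀ c : T, a ⊓ b ≤ c → (c ≤ a ∨ c ≤ b) → c ∈ X

/-- `c` is a child of `e`. -/
def IsChild {T : RootedTree} (c e : T) : Prop := c ≠ ⊥ ∧ Order.pred c = e

theorem IsChild.lt {T : RootedTree} {c e : T} (h : IsChild c e) : e < c := by
  obtain ⟨h1, rfl⟩ := h
  exact Order.pred_lt_of_not_isMin (fun hm => h1 hm.eq_bot)

open scoped Classical in
/-- `key(e) = e ∩ p_e`, where `attr` gives the attribute sets of the nodes; `key(r) = ∅`. -/
noncomputable def treeKey {V : Type*} {T : RootedTree} (attr : T → Finset V) (e : T) :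
    Finset V :=
  if e = ⊥ then ∅ else attr e ∩ attr (Order.pred e)

/-- A free-connex join tree of `Q` on the rooted tree `T`, with its connex subtree `con`.
The nodes in the range of `node` correspond to input relations, the others to generalized
relations. -/
structure FreeConnexTree {V I : Type*} (Q : CQ V I) (T : RootedTree) where
  node : I → T
  attr : T → Finset V
  con : Set T
  node_injective : Function.Injective node
  attr_node : ∀ i, attr (node i) = Q.att i
  leaf : ∀ e, (∀ c, ¬ IsChild c e) → e ∈ Set.range node
  connect : ∀ x, TreeConnected {e | x ∈ attr e}
  guard : ∀ e, e ∉ Set.range node → ∀ c, IsChild c e → attr e ⊆ attr c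
  above : ∀ e, e ∉ Set.range node → ∀ i, ¬ node i ≤ e
  con_connected : TreeConnected con
  con_root : ⊥ ∈ con
  con_key : ∀ e ∈ con, treeKey attr e ⊆ Q.out
  con_out : ∀ x ∈ Q.out, ∃ e ∈ con, x ∈ attr e

namespace FreeConnexTree

variable {V I : Type*} {Q : CQ V I} {T : RootedTree} {Dom : Type*}

/-- `key(e)`. -/
noncomputable def key (F : FreeConnexTree Q T) (e : T) : Finset V := treeKey F.attr e

open scoped Classical in
/-- `y ∩ e`. -/
noncomputable def oattr (F : FreeConnexTree Q T) (e : T) : Finset V := Q.out ∩ F.attr e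

theorem key_subset_attr (F : FreeConnexTree Q T) (e : T) : F.key e ⊆ F.attr e := by
  classical
  intro x hx
  unfold key treeKey at hx
  split_ifs at hx with h
  · simp at hx
  · exact (Finset.mem_inter.mp hx).1

theorem key_subset_parent (F : FreeConnexTree Q T) (e : T) :
    F.key e ⊆ F.attr (Order.pred e) := by
  classical
  intro x hx
  unfold key treeKey at hx
  split_ifs at hx with h
  · simp at hx
  · exact (Finset.mem_inter.mp hx).2

theorem oattr_subset_out (F : FreeConnexTree Q T) (e : T) : F.oattr e ⊆ Q.out := by
  classical exact Finset.inter_subset_left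

theorem oattr_subset_attr (F : FreeConnexTree Q T) (e : T) : F.oattr e ⊆ F.attr e := by
  classical exact Finset.inter_subset_right

theorem key_subset_oattr (F : FreeConnexTree Q T) {e : T} (he : e ∈ F.con) :
    F.key e ⊆ F.oattr e := by
  classical exact Finset.subset_inter (F.con_key e he) (F.key_subset_attr e)

theorem key_subset_oattr_parent (F : FreeConnexTree Q T) {e : T} (he : e ∈ F.con) :
    F.key e ⊆ F.oattr (Order.pred e) := by
  classical exact Finset.subset_inter (F.con_key e he) (F.key_subset_parent e)

theorem ncard_Ioi_lt [Finite T] {c e : T} (h : e < c) :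
    (Set.Ioi c).ncard < (Set.Ioi e).ncard :=
  Set.ncard_lt_ncard ⟨Set.Ioi_subset_Ioi h.le, fun h' => lt_irrefl c (h' h)⟩

theorem ncard_Iio_lt [Finite T] {e : T} (h : ¬ e = ⊥) :
    (Set.Iio (Order.pred e)).ncard < (Set.Iio e).ncard :=
  have hlt : Order.pred e < e := IsChild.lt ⟨h, rfl⟩
  Set.ncard_lt_ncard ⟨Set.Iio_subset_Iio hlt.le, fun h' => lt_irrefl _ (h' hlt)⟩

/-! ### The views -/

/-- The semi-join view `V_s(R_e)`: the tuples over `e` that belong to `R_e`, if `e` corresponds to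
an input relation, and whose projection to `key(c)` is in `V_p(R_c) = π_{key(c)} V_s(R_c)` for
every child `c`. At a generalized relation this is the intersection of the `V_p(R_c)`, since there
`key(c) = e` for every child and there is at least one child. -/
def semi [Finite T] (F : FreeConnexTree Q T) (D : Database Q Dom) (e : T) :
    Set (Tup Dom (F.attr e)) :=
  {u | (∀ i, (h : F.node i = e) → Tup.proj (h ▸ (F.attr_node i).ge) u ∈ D i) ∧
    ∀ c, (hc : IsChild c e) →
      Tup.proj (hc.2 ▸ F.key_subset_parent c) u ∈
        Tup.proj (F.key_subset_attr c) '' semi F D c}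
termination_by (Set.Ioi e).ncard
decreasing_by exact ncard_Ioi_lt hc.lt

/-- The projection view `V_p(R_e)`. -/
def pview [Finite T] (F : FreeConnexTree Q T) (D : Database Q Dom) (e : T) :
    Set (Tup Dom (F.key e)) :=
  Tup.proj (F.key_subset_attr e) '' F.semi D e

/-- `π_{y ∩ e} V_s(R_e)`. -/
def osemi [Finite T] (F : FreeConnexTree Q T) (D : Database Q Dom) (e : T) :
    Set (Tup Dom (F.oattr e)) :=
  Tup.proj (F.oattr_subset_attr e) '' F.semi D e

/-- The live view `V_l(R_e) = π_{y ∩ e} Q(D)`. -/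
def live (F : FreeConnexTree Q T) (D : Database Q Dom) (e : T) : Set (Tup Dom (F.oattr e)) :=
  Tup.proj (F.oattr_subset_out e) '' Q.eval D

/-- `Q(D ⋉ t')` for a tuple `t'` over `y ∩ e`: the results of `Q` on `D` that arise from tuples
of the join that agree with `t'`. -/
def witnessed (F : FreeConnexTree Q T) (D : Database Q Dom) (e : T) (t' : Tup Dom (F.oattr e)) :
    Set (Tup Dom Q.out) :=
  {q | ∃ a : V → Dom, (∀ i, restr (Q.att i) a ∈ D i) ∧ restr (F.oattr e) a = t' ∧
    q = restr Q.out a}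

/-- The tuple `t'` at the node `e` is a witness of the update `U` of `D`: `e` is in the connex
subtree, `t'` is in the delta of `π_{y ∩ e} V_s(R_e)`, and, unless `e` is the root, the propagation
stops at `e` (the projection of `t'` to `key(e)` is not in the delta of `V_p(R_e)`), while `t'`
joins with the live view of the parent before the update. -/
def IsWitness [Finite T] (F : FreeConnexTree Q T) (D : Database Q Dom) (U : Update Q Dom)
    (e : T) (t' : Tup Dom (F.oattr e)) : Prop :=
  ∃ he : e ∈ F.con,
    t' ∈ U.delta (fun D' => F.osemi D' e) D ∧
    (e ≠ ⊥ →
      Tup.proj (F.key_subset_oattr he) t' ∉ U.delta (fun D' => F.pview D' e) D ∧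
      Tup.proj (F.key_subset_oattr he) t' ∈
        Tup.proj (F.key_subset_oattr_parent he) '' F.live D (Order.pred e))

end FreeConnexTree

/-! ### The stored data structure

Hash indexes: for every bucket key, a linked list of the tuples of the view with this key. -/

/-- The indexes that the enumeration uses, one of each sort for a non-root node `e` of the connex
subtree: `ofSemi e` is an index on `π_{y ∩ e} V_s(R_e)` and `ofLive e` is an index on the live view
`V_l(R_{p_e})` of the parent of `e`; both are hashed on `key(e)`. -/
inductive Index (T : RootedTree)
  | ofSemi (e : T)
  | ofLive (e : T)

namespace FreeConnexTree

variable {V I : Type*} {Q : CQ V I} {T : RootedTree}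

/-- The attributes on which an index is hashed. -/
noncomputable def ixKey (F : FreeConnexTree Q T) : Index T → Finset V
  | .ofSemi e => F.key e
  | .ofLive e => F.key e

/-- The attributes of the indexed view. -/
noncomputable def ixCols (F : FreeConnexTree Q T) : Index T → Finset V
  | .ofSemi e => F.oattr e
  | .ofLive e => F.oattr (Order.pred e)

/-- The node to which an index belongs. -/
def ixNode : Index T → T
  | .ofSemi e => e
  | .ofLive e => e

/-- The indexed view, during the processing of the update `U` of `D`: semi-join views are those
of the database on which the delta is enumerated, live views are those before the update. -/
def ixView [Finite T] (F : FreeConnexTree Q T) {Dom : Type*} (D : Database Q Dom)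
    (U : Update Q Dom) : (ix : Index T) → Set (Tup Dom (F.ixCols ix))
  | .ofSemi e => F.osemi (U.enumDB D) e
  | .ofLive e => F.live D (Order.pred e)

/-- The contents of the memory: the buckets of the indexes, and the list of the witness tuples
(with their nodes) found during change propagation. A bucket key is given by registers that
contain a value or are empty. -/
structure Store (F : FreeConnexTree Q T) (Dom : Type*) where
  bucket : ∀ ix : Index T, ({x // x ∈ F.ixKey ix} → Option Dom) → List (Tup Dom (F.ixCols ix))
  witnesses : List (Σ e : T, Tup Dom (F.oattr e))

/-- The store holds, in some order and without repetition, the right tuples. (For a node of the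
connex subtree the attributes of the key are among those of the indexed view.) -/
structure Store.Represents [Finite T] {F : FreeConnexTree Q T} {Dom : Type*}
    (S : Store F Dom) (D : Database Q Dom) (U : Update Q Dom) : Prop where
  bucket_nodup : ∀ ix, ixNode ix ∈ F.con → ixNode ix ≠ ⊥ → ∀ k, (S.bucket ix k).Nodup
  mem_bucket : ∀ ix, ixNode ix ∈ F.con → ixNode ix ≠ ⊥ → ∀ k u,
    u ∈ S.bucket ix k ↔ u ∈ F.ixView D U ix ∧
      ∀ x (h₁ : x ∈ F.ixKey ix) (h₂ : x ∈ F.ixCols ix), k ⟨x, h₁⟩ = some (u ⟨x, h₂⟩)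
  witnesses_nodup : S.witnesses.Nodup
  mem_witnesses : ∀ e t', ⟨e, t'⟩ ∈ S.witnesses ↔ F.IsWitness D U e t'

/-! Sanity check: such a store always exists. -/

theorem proj_injective_of_subset {V Dom : Type*} {s t : Finset V} (h : s ⊆ t) (h' : t ⊆ s) :
    Function.Injective (Tup.proj (Dom := Dom) h) := by
  intro u v huv
  funext x
  exact congrFun huv ⟨x.1, h' x.2⟩

theorem semi_finite [Finite T] (F : FreeConnexTree Q T) {Dom : Type*} (D : Database Q Dom) (e : T) :
    (F.semi D e).Finite := by
  induction e using (wellFounded_gt (α := T)).induction with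
  | _ e ih =>
    by_cases he : e ∈ Set.range F.node
    · obtain ⟨i, rfl⟩ := he
      refine Set.Finite.of_finite_image (f := Tup.proj (F.attr_node i).ge)
        ((D i).finite_toSet.subset ?_)
        (proj_injective_of_subset _ (F.attr_node i).le).injOn
      rintro _ ⟨u, hu, rfl⟩
      rw [semi] at hu
      exact hu.1 i rfl
    · have hc : ∃ c, IsChild c e := by
        by_contra hcon
        exact he (F.leaf e (fun c hc => hcon ⟨c, hc⟩))
      obtain ⟨c, hc⟩ := hc
      have hsub : F.attr e ⊆ F.key c := by
        classical
        intro x hx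
        unfold key treeKey
        rw [if_neg hc.1, Finset.mem_inter, hc.2]
        exact ⟨F.guard e he c hc hx, hx⟩
      refine Set.Finite.of_finite_image (f := Tup.proj (hc.2 ▸ F.key_subset_parent c))
        (((ih c hc.lt).image (Tup.proj (F.key_subset_attr c))).subset ?_)
        (proj_injective_of_subset _ hsub).injOn
      rintro _ ⟨u, hu, rfl⟩
      rw [semi] at hu
      exact hu.2 c hc

theorem eval_subset_osemi [Finite T] (F : FreeConnexTree Q T) {Dom : Type*} (D : Database Q Dom)
    (a : V → Dom) (ha : ∀ i, restr (Q.att i) a ∈ D i) (e : T) : restr (F.attr e) a ∈ F.semi D e := by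
  induction e using (wellFounded_gt (α := T)).induction with
  | _ e ih =>
    rw [semi]
    refine ⟨?_, fun c hc => ⟨_, ih c hc.lt, rfl⟩⟩
    rintro i rfl
    exact ha i

theorem osemi_finite [Finite T] (F : FreeConnexTree Q T) {Dom : Type*} (D : Database Q Dom)
    (e : T) : (F.osemi D e).Finite := (F.semi_finite D e).image _

theorem live_finite [Finite T] (F : FreeConnexTree Q T) {Dom : Type*} (D : Database Q Dom)
    (e : T) : (F.live D e).Finite := by
  refine (F.osemi_finite D e).subset ?_
  rintro _ ⟨_, ⟨a, ha, rfl⟩, rfl⟩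
  exact ⟨_, F.eval_subset_osemi D a ha e, rfl⟩

theorem Store.exists_represents [Finite T] (F : FreeConnexTree Q T) {Dom : Type*}
    (D : Database Q Dom) (U : Update Q Dom) : ∃ S : Store F Dom, S.Represents D U := by
  classical
  have h1 : ∀ ix, (F.ixView D U ix).Finite := by
    rintro (e | e)
    · exact F.osemi_finite _ e
    · exact F.live_finite D _
  have h2 : {w : Σ e : T, Tup Dom (F.oattr e) | F.IsWitness D U w.1 w.2}.Finite := by
    have h3 : ∀ e : T, (U.delta (fun D' => F.osemi D' e) D).Finite := by
      intro e
      unfold Update.delta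
      split
      · exact (F.osemi_finite _ e).sdiff
      · exact (F.osemi_finite _ e).sdiff
    refine (Set.finite_iUnion (fun e : T => (h3 e).image (fun t => (⟨e, t⟩ :
      Σ e : T, Tup Dom (F.oattr e))))).subset ?_
    rintro ⟨e, t⟩ ⟨_, ht, _⟩
    exact Set.mem_iUnion.mpr ⟨e, t, ht, rfl⟩
  refine ⟨⟨fun ix k => ((h1 ix).subset (t := {u | u ∈ F.ixView D U ix ∧
    ∀ x (h₁ : x ∈ F.ixKey ix) (h₂ : x ∈ F.ixCols ix), k ⟨x, h₁⟩ = some (u ⟨x, h₂⟩)})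
    (fun u hu => hu.1)).toFinset.toList, h2.toFinset.toList⟩, ?_, ?_, ?_, ?_⟩
  · intro ix _ _ k
    exact Finset.nodup_toList _
  · intro ix _ _ k u
    simp
  · exact Finset.nodup_toList _
  · intro e t
    simp

end FreeConnexTree

/-! ### The machine

Programs are syntactic objects that do not depend on the data. The machine has one register for
every attribute and a stack of frames. -/

/-- `emit` outputs the registers of the output attributes; `probe ix body` looks up the bucket of
`ix` whose key is in the registers, and runs `body` for each of its tuples, loaded into the
registers; `forWitness body` runs `body e` for each witness tuple `(e, t')`, loaded into the
registers. -/
inductive Prog (T : RootedTree)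
  | emit
  | probe (ix : Index T) (body : Prog T)
  | forWitness (body : T → Prog T)

namespace FreeConnexTree

variable {V I : Type*} {Q : CQ V I} {T : RootedTree} {Dom : Type*}

abbrev Regs (V Dom : Type*) : Type _ := V → Option Dom

open scoped Classical in
/-- Load a tuple into the registers. -/
noncomputable def load {s : Finset V} (u : Tup Dom s) (ρ : Regs V Dom) : Regs V Dom :=
  fun x => if h : x ∈ s then some (u ⟨x, h⟩) else ρ x

/-- A frame: a program that is to be run, or a loop with a cursor into a list. -/
inductive Frame (F : FreeConnexTree Q T) (Dom : Type*)
  | run (p : Prog T) (ρ : Regs V Dom)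
  | scan (ix : Index T) (rest : List (Tup Dom (F.ixCols ix))) (body : Prog T) (ρ : Regs V Dom)
  | scanW (rest : List (Σ e : T, Tup Dom (F.oattr e))) (body : T → Prog T) (ρ : Regs V Dom)

abbrev Config (F : FreeConnexTree Q T) (Dom : Type*) : Type _ := List (Frame F Dom)

/-- One step of the machine, and its output, if there is one. A step does one output, one hash
lookup, or one advance of a cursor, and moves at most `|V|` register contents; so it takes constant
time in data complexity. The machine has halted when the stack is empty. -/
noncomputable def step {F : FreeConnexTree Q T} (S : Store F Dom) :
    Config F Dom → Config F Dom × Option ({x // x ∈ Q.out} → Option Dom)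
  | [] => ([], none)
  | .run .emit ρ :: K => (K, some (fun x => ρ x.1))
  | .run (.probe ix body) ρ :: K =>
      (.scan ix (S.bucket ix (fun x => ρ x.1)) body ρ :: K, none)
  | .run (.forWitness body) ρ :: K => (.scanW S.witnesses body ρ :: K, none)
  | .scan _ [] _ _ :: K => (K, none)
  | .scan ix (u :: us) body ρ :: K => (.run body (load u ρ) :: .scan ix us body ρ :: K, none)
  | .scanW [] _ _ :: K => (K, none)
  | .scanW (w :: ws) body ρ :: K => (.run (body w.1) (load w.2 ρ) :: .scanW ws body ρ :: K, none)

/-- `SilentSteps S n K K'`: from `K` the machine reaches `K'` in `n` steps without any output. -/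
inductive SilentSteps {F : FreeConnexTree Q T} (S : Store F Dom) :
    ℕ → Config F Dom → Config F Dom → Prop
  | refl (K) : SilentSteps S 0 K K
  | cons {n K K₁ K'} : step S K = (K₁, none) → SilentSteps S n K₁ K' →
      SilentSteps S (n + 1) K K'

/-- Started in `K`, the machine outputs exactly the tuples of the list, in this order, and halts;
the number of steps from the start to the first output, between consecutive outputs, and from the
last output to the halt, is at most `c`. -/
inductive EnumeratesWithDelay {F : FreeConnexTree Q T} (S : Store F Dom) (c : ℕ) :
    Config F Dom → List (Tup Dom Q.out) → Prop
  | halt {n K} : n ≤ c → SilentSteps S n K [] → EnumeratesWithDelay S c K []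
  | output {n K K' K'' q qs} : n + 1 ≤ c → SilentSteps S n K K' →
      step S K' = (K'', some (fun x => some (q x))) → EnumeratesWithDelay S c K'' qs →
      EnumeratesWithDelay S c K (q :: qs)

/-! ### The algorithms -/

open scoped Classical in
/-- Loop over the join of the tuple over `y ∩ e` in the registers with the live views of all proper
ancestors of `e`. -/
noncomputable def climb [Finite T] (e : T) (body : Prog T) : Prog T :=
  if e = ⊥ then body else .probe (.ofLive e) (climb (Order.pred e) body)
termination_by (Set.Iio e).ncard
decreasing_by exact ncard_Iio_lt ‹_›

variable [Finite T]

/-- The children of a node, in some fixed order. -/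
noncomputable def children (e : T) : List {c : T // IsChild c e} :=
  (Set.toFinite (Set.univ : Set {c : T // IsChild c e})).toFinset.toList

open scoped Classical in
/-- The loop `foreach s ∈ FullEnum(T_e, e, t) do body`, where the key `t` is in the registers for
`key(e)`: nothing is added to the results if `e` is not in the connex subtree; otherwise loop over
the tuples `t₀` of `π_{y ∩ e} V_s(R_e)` with this key and, nested inside, over the results of
`FullEnum(T_c, c, t₀[key(c)])` for all children `c`. When `body` is run, the registers contain the
result `s`. -/
noncomputable def fullEnum (F : FreeConnexTree Q T) (e : T) (body : Prog T) : Prog T :=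
  if e ∈ F.con then
    .probe (.ofSemi e) ((children e).foldr (fun c p => fullEnum F c.1 p) body)
  else body
termination_by (Set.Ioi e).ncard
decreasing_by exact ncard_Ioi_lt c.2.lt

open scoped Classical in
/-- Nested loops over the results of `FullEnum` on `T_{p_e} - T_e`, `T_{p_{p_e}} - T_{p_e}`, ...,
up to the root, where the tuples at the proper ancestors of `e` themselves are in the registers. -/
noncomputable def enumAbove (F : FreeConnexTree Q T) (e : T) (body : Prog T) : Prog T :=
  if e = ⊥ then body
  else
    ((children (Order.pred e)).filter (fun c => c.1 ≠ e)).foldr (fun c p => F.fullEnum c.1 p)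
      (enumAbove F (Order.pred e) body)
termination_by (Set.Iio e).ncard
decreasing_by exact ncard_Iio_lt ‹_›

/-- `DeltaEnum`: for each witness tuple `t'`, at a node `e`, for each `q` in the join of `t'` with
the live views of the proper ancestors of `e`, output the combinations of the results of `FullEnum`
on `T_e` and on the trees `T_{e_j} - T_{e_{j-1}}` along the path from `e` to the root, with the
tuples at `e` and at its ancestors fixed to those of `q`. -/
noncomputable def deltaEnum (F : FreeConnexTree Q T) : Prog T :=
  .forWitness fun e =>
    climb e ((children e).foldr (fun c p => F.fullEnum c.1 p) (F.enumAbove e .emit))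

/-- The initial configuration: all registers are empty. -/
noncomputable def start (F : FreeConnexTree Q T) (Dom : Type*) : Config F Dom :=
  [.run F.deltaEnum (fun _ => none)]

end FreeConnexTree

/-!
The proof compares `U.enumDB D` with the smaller database `U.lowDB D`, so that the delta of every
view is a difference of its values on these two. Two ideas carry it.

*Decomposition.* Tuples chosen from the semi-join views that agree along the edges of the join tree
glue to a tuple of the join (`exists_join_of_step`), and keys of nodes in the connex subtree consist
of output attributes. Hence `q` is a result if and only if its projections lie in the semi-join
views on the connex subtree (`mem_eval_iff`), and any part of the connex subtree that contains the
root extends to a result (`exists_eval_agree`). For a new result `q`, the nodes whose semi-join view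
gains the projection of `q` lie on the path from the updated relation to the root; once the
propagation stops at a node, nothing above it changes (`mem_osemi_lowDB_of_lt`). So these nodes form
an interval of the path, with a unique top node, and the projection of `q` to `e` is a witness
exactly if `e` is this top node (`isWitness_atNode_iff`). The part of `q` strictly above it extends
to an old result (`IsTop.atNode_mem_live`), which is why the algorithm may use the live views before
the update.

*Delay.* For each witness the program is a nest of index loops whose depth depends on the tree only.
Each loop loads one new node, adjacent to the loaded ones (`Plan`), so by connectedness the new
tuple overlaps the registers only in the key of the loop. It follows that no lookup finds an empty
bucket and that the outputs are the results contributed by the witness, without repetition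
(`Plan.exists_yields`). In a loop nest of depth `d` without empty buckets, at most `d` exhausted
loops are left between two outputs, one cursor is advanced, and at most `d` loops are entered again
(`Yields.enumeratesFrom`).
-/

/-! ### Rooted trees -/

namespace RootedTree

variable {T : RootedTree}

theorem pred_lt_of_ne_bot {e : T} (h : e ≠ ⊥) : Order.pred e < e := IsChild.lt ⟨h, rfl⟩

/-- The ancestors of a node form a chain. -/
theorem le_total_of_le_of_le {a b c : T} (ha : a ≤ c) (hb : b ≤ c) : a ≤ b ∨ b ≤ a :=
  le_total_of_directed hb ha

theorem eq_of_isChild_of_le {p c c' f : T} (h : IsChild c p) (h' : IsChild c' p) (hf : c ≤ f)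
    (hf' : c' ≤ f) : c = c' := by
  have key : ∀ {a b : T}, IsChild a p → IsChild b p → a ≤ b → a = b := by
    intro a b ha hb hab
    by_contra hne
    have hle := Order.le_pred_of_lt (lt_of_le_of_ne hab hne)
    rw [hb.2] at hle
    exact absurd ha.lt hle.not_gt
  rcases le_total_of_le_of_le hf hf' with hab | hab
  · exact key h h' hab
  · exact (key h' h hab).symm

theorem exists_isChild_le {e f : T} (h : e < f) : ∃ c, IsChild c e ∧ c ≤ f := by
  have key : ∀ n : ℕ, ∀ f : T, e < f → Order.pred^[n] f = e → ∃ c, IsChild c e ∧ c ≤ f := by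
    intro n
    induction n with
    | zero => exact fun f hf hn => absurd hn hf.ne'
    | succ n ih =>
      intro f hf hn
      rw [Function.iterate_succ_apply] at hn
      rcases (Order.le_pred_of_lt hf).eq_or_lt with heq | hlt
      · exact ⟨f, ⟨hf.ne_bot, heq.symm⟩, le_rfl⟩
      · obtain ⟨c, hc, hcf⟩ := ih _ hlt hn
        exact ⟨c, hc, hcf.trans (Order.pred_le f)⟩
  obtain ⟨n, hn⟩ := h.le.exists_pred_iterate
  exact key n f h hn

end RootedTree

/-- A connected set that contains a node `e` and a node `f` outside the subtree of `e` contains the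
parent of `e`. -/
theorem TreeConnected.pred_mem {T : RootedTree} {X : Set T} (hX : TreeConnected X) {e f : T}
    (he : e ∈ X) (hf : f ∈ X) (hef : ¬ e ≤ f) : Order.pred e ∈ X := by
  refine hX e he f hf _ (Order.le_pred_of_lt ?_) (Or.inl (Order.pred_le e))
  exact lt_of_le_of_ne inf_le_left (fun h => hef (inf_eq_left.mp h))

namespace FreeConnexTree

open RootedTree

variable {V I : Type*} {Q : CQ V I} {T : RootedTree} {Dom : Type*}

/-! ### Attributes and projections -/

theorem con_of_le (F : FreeConnexTree Q T) {e f : T} (hf : f ∈ F.con) (h : e ≤ f) : e ∈ F.con :=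
  F.con_connected ⊥ F.con_root f hf e (by simp) (Or.inr h)

theorem mem_key (F : FreeConnexTree Q T) {e : T} (he : e ≠ ⊥) {x : V} :
    x ∈ F.key e ↔ x ∈ F.attr e ∧ x ∈ F.attr (Order.pred e) := by
  classical
  unfold key treeKey
  rw [if_neg he, Finset.mem_inter]

theorem mem_oattr (F : FreeConnexTree Q T) {e : T} {x : V} :
    x ∈ F.oattr e ↔ x ∈ Q.out ∧ x ∈ F.attr e := by
  classical
  unfold oattr
  rw [Finset.mem_inter]

theorem isLowerSet_con (F : FreeConnexTree Q T) : IsLowerSet F.con :=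
  fun _ _ h hf => F.con_of_le hf h

/-- The projection of a tuple over `y` to `y ∩ e`. -/
noncomputable abbrev atNode (F : FreeConnexTree Q T) (q : Tup Dom Q.out) (e : T) :
    Tup Dom (F.oattr e) :=
  Tup.proj (F.oattr_subset_out e) q

/-- The projection of a tuple over `y` to `key(e)`. -/
noncomputable abbrev keyAt (F : FreeConnexTree Q T) {e : T} (he : e ∈ F.con) (q : Tup Dom Q.out) :
    Tup Dom (F.key e) := Tup.proj (F.con_key e he) q

theorem eq_of_atNode_eq (F : FreeConnexTree Q T) {q q' : Tup Dom Q.out}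
    (h : ∀ f ∈ F.con, F.atNode q f = F.atNode q' f) : q = q' := by
  funext x
  obtain ⟨e, he, hx⟩ := F.con_out x.1 x.2
  exact congrFun (h e he) ⟨x.1, F.mem_oattr.mpr ⟨x.2, hx⟩⟩

theorem mem_witnessed_iff (F : FreeConnexTree Q T) {D : Database Q Dom} {e : T}
    {t' : Tup Dom (F.oattr e)} {q : Tup Dom Q.out} :
    q ∈ F.witnessed D e t' ↔ q ∈ Q.eval D ∧ F.atNode q e = t' := by
  constructor
  · rintro ⟨a, ha, rfl, rfl⟩
    exact ⟨⟨a, ha, rfl⟩, rfl⟩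
  · rintro ⟨⟨a, ha, rfl⟩, rfl⟩
    exact ⟨a, ha, rfl, rfl⟩

/-! ### Gluing local tuples to a tuple of the join -/

/-- Tuples at the nodes that agree along the edges of the join tree are the restrictions of a
single assignment. -/
theorem exists_assignment (F : FreeConnexTree Q T) (u : ∀ f : T, Tup Dom (F.attr f))
    (hu : ∀ f, f ≠ ⊥ → ∀ x (h : x ∈ F.attr f) (h' : x ∈ F.attr (Order.pred f)),
      u f ⟨x, h⟩ = u (Order.pred f) ⟨x, h'⟩) :
    ∃ a : V → Dom, ∀ f, restr (F.attr f) a = u f := by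
  have up : ∀ (x : V) (g : T) (n : ℕ) (f : T), g ≤ f → Order.pred^[n] f = g →
      (∀ h, g ≤ h → h ≤ f → x ∈ F.attr h) → ∀ (hf : x ∈ F.attr f) (hg : x ∈ F.attr g),
      u f ⟨x, hf⟩ = u g ⟨x, hg⟩ := by
    intro x g n
    induction n with
    | zero =>
      rintro f - rfl - hf hg
      rfl
    | succ n ih =>
      intro f hgf hn hx hf hg
      rcases hgf.eq_or_lt with rfl | hlt
      · rfl
      · rw [Function.iterate_succ_apply] at hn
        have hle := Order.le_pred_of_lt hlt
        rw [hu f hlt.ne_bot x hf (hx _ hle (Order.pred_le f))]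
        exact ih _ hle hn (fun h h1 h2 => hx h h1 (h2.trans (Order.pred_le f))) _ _
  have agree : ∀ (x : V) (e f : T) (he : x ∈ F.attr e) (hf : x ∈ F.attr f),
      u e ⟨x, he⟩ = u f ⟨x, hf⟩ := by
    intro x e f he hf
    have hc := F.connect x e he f hf
    have hm : x ∈ F.attr (e ⊓ f) := hc _ le_rfl (Or.inl inf_le_left)
    obtain ⟨n, hn⟩ := (inf_le_left : e ⊓ f ≤ e).exists_pred_iterate
    obtain ⟨m, hm'⟩ := (inf_le_right : e ⊓ f ≤ f).exists_pred_iterate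
    rw [up x _ n e inf_le_left hn (fun h h1 h2 => hc h h1 (Or.inl h2)) he hm,
      up x _ m f inf_le_right hm' (fun h h1 h2 => hc h h1 (Or.inr h2)) hf hm]
  have cov : ∀ x : V, ∃ e, x ∈ F.attr e := by
    intro x
    obtain ⟨i, hi⟩ := Q.cover x
    exact ⟨F.node i, by rwa [F.attr_node]⟩
  choose e he using cov
  exact ⟨fun x => u (e x) ⟨x, he x⟩, fun f => funext fun x => agree x.1 _ _ _ _⟩

variable [Finite T]

/-- Tuples of the semi-join views can be chosen from the root downwards: if `G` selects tuples of
these views such that every selected tuple of a parent has a selected partner at each child, then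
some tuple of the join restricts to selected tuples everywhere. -/
theorem exists_join_of_step (F : FreeConnexTree Q T) (D : Database Q Dom)
    (G : ∀ f : T, Set (Tup Dom (F.attr f))) (hG : ∀ f, G f ⊆ F.semi D f) (hroot : (G ⊥).Nonempty)
    (hstep : ∀ f, f ≠ ⊥ → ∀ v ∈ G (Order.pred f), ∃ w ∈ G f,
      ∀ x (h : x ∈ F.attr f) (h' : x ∈ F.attr (Order.pred f)), w ⟨x, h⟩ = v ⟨x, h'⟩) :
    ∃ a : V → Dom, (∀ i, restr (Q.att i) a ∈ D i) ∧ ∀ f, restr (F.attr f) a ∈ G f := by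
  classical
  have hstep' : ∀ f, f ≠ ⊥ → ∀ v : {v // v ∈ G (Order.pred f)}, ∃ w : {w // w ∈ G f},
      ∀ x (h : x ∈ F.attr f) (h' : x ∈ F.attr (Order.pred f)), w.1 ⟨x, h⟩ = v.1 ⟨x, h'⟩ :=
    fun f hf v => by
      obtain ⟨w, hw, h⟩ := hstep f hf v.1 v.2
      exact ⟨⟨w, hw⟩, h⟩
  choose next hnext using hstep'
  let g : ∀ f : T, {v // v ∈ G f} := (wellFounded_lt (α := T)).fix fun f ih =>
    if h : f = ⊥ then h ▸ ⟨hroot.some, hroot.some_mem⟩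
    else next f h (ih (Order.pred f) (pred_lt_of_ne_bot h))
  have hg : ∀ f (h : f ≠ ⊥), g f = next f h (g (Order.pred f)) := by
    intro f h
    have := (wellFounded_lt (α := T)).fix_eq (C := fun f => {v // v ∈ G f}) (fun f ih =>
      if h : f = ⊥ then h ▸ ⟨hroot.some, hroot.some_mem⟩
      else next f h (ih (Order.pred f) (pred_lt_of_ne_bot h))) f
    rw [dif_neg h] at this
    exact this
  obtain ⟨a, ha⟩ := F.exists_assignment (fun f => (g f).1) (by
    intro f hf x h h'
    rw [hg f hf]
    exact hnext f hf _ x h h')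
  refine ⟨a, fun i => ?_, fun f => ha f ▸ (g f).2⟩
  have h1 : restr (F.attr (F.node i)) a ∈ F.semi D (F.node i) := by
    rw [ha]
    exact hG _ (g _).2
  rw [semi] at h1
  exact h1.1 i rfl

theorem exists_semi_child (F : FreeConnexTree Q T) {D : Database Q Dom} {f : T} (hf : f ≠ ⊥)
    {v : Tup Dom (F.attr (Order.pred f))} (hv : v ∈ F.semi D (Order.pred f)) :
    ∃ w ∈ F.semi D f, ∀ x (h : x ∈ F.attr f) (h' : x ∈ F.attr (Order.pred f)),
      w ⟨x, h⟩ = v ⟨x, h'⟩ := by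
  rw [semi] at hv
  obtain ⟨w, hw, h⟩ := hv.2 f ⟨hf, rfl⟩
  exact ⟨w, hw, fun x h1 h2 => congrFun h ⟨x, (F.mem_key hf).mpr ⟨h1, h2⟩⟩⟩

/-- If the projections of `q` lie in the semi-join views on a subtree `X` of the connex subtree
that contains the root, then some result of the query agrees with `q` on `X`. -/
theorem exists_eval_agree (F : FreeConnexTree Q T) (D : Database Q Dom) (q : Tup Dom Q.out)
    (X : Set T) (hXc : X ⊆ F.con) (hroot : ⊥ ∈ X) (hX : IsLowerSet X)
    (hq : ∀ f ∈ X, F.atNode q f ∈ F.osemi D f) :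
    ∃ q' ∈ Q.eval D, ∀ f ∈ X, F.atNode q' f = F.atNode q f := by
  obtain ⟨a, ha, hG⟩ := F.exists_join_of_step D
    (fun f => {v | v ∈ F.semi D f ∧ (f ∈ X → Tup.proj (F.oattr_subset_attr f) v = F.atNode q f)})
    (fun f v hv => hv.1)
    (by
      obtain ⟨v, hv, h⟩ := hq ⊥ hroot
      exact ⟨v, hv, fun _ => h⟩)
    (by
      rintro f hf v ⟨hv, hvq⟩
      by_cases hfX : f ∈ X
      -- The chosen tuples fit together on `key(f)` because it consists of output attributes.
      · obtain ⟨w, hw, h⟩ := hq f hfX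
        refine ⟨w, ⟨hw, fun _ => h⟩, fun x h1 h2 => ?_⟩
        have hout : x ∈ Q.out := F.con_key f (hXc hfX) ((F.mem_key hf).mpr ⟨h1, h2⟩)
        have e1 := congrFun h ⟨x, F.mem_oattr.mpr ⟨hout, h1⟩⟩
        have e2 := congrFun (hvq (hX (Order.pred_le f) hfX)) ⟨x, F.mem_oattr.mpr ⟨hout, h2⟩⟩
        exact e1.trans e2.symm
      · obtain ⟨w, hw, h⟩ := F.exists_semi_child hf hv
        exact ⟨w, ⟨hw, fun h' => absurd h' hfX⟩, h⟩)
  exact ⟨restr Q.out a, ⟨a, ha, rfl⟩, fun f hf => (hG f).2 hf⟩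

theorem mem_osemi_of_mem_eval (F : FreeConnexTree Q T) {D : Database Q Dom} {q : Tup Dom Q.out}
    (hq : q ∈ Q.eval D) (e : T) : F.atNode q e ∈ F.osemi D e := by
  obtain ⟨a, ha, rfl⟩ := hq
  exact ⟨_, F.eval_subset_osemi D a ha e, rfl⟩

/-- The free-connex property: membership in the query result can be tested at the nodes of the
connex subtree. -/
theorem mem_eval_iff (F : FreeConnexTree Q T) {D : Database Q Dom} {q : Tup Dom Q.out} :
    q ∈ Q.eval D ↔ ∀ f ∈ F.con, F.atNode q f ∈ F.osemi D f := by
  refine ⟨fun h f _ => F.mem_osemi_of_mem_eval h f, fun h => ?_⟩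
  obtain ⟨q', hq', h'⟩ := F.exists_eval_agree D q F.con subset_rfl F.con_root F.isLowerSet_con h
  rwa [F.eq_of_atNode_eq h'] at hq'

/-! ### Effect of an update on the views -/

theorem semi_mono (F : FreeConnexTree Q T) {D D' : Database Q Dom} (h : ∀ i, D i ⊆ D' i) (e : T) :
    F.semi D e ⊆ F.semi D' e := by
  induction e using (wellFounded_gt (α := T)).induction with
  | _ e ih =>
    intro u hu
    rw [semi] at hu ⊢
    refine ⟨fun i hi => h i (hu.1 i hi), fun c hc => ?_⟩
    obtain ⟨w, hw, h'⟩ := hu.2 c hc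
    exact ⟨w, ih c hc.lt hw, h'⟩

/-- A change of one relation affects the semi-join views only at its ancestors. -/
theorem semi_subset_of_not_le (F : FreeConnexTree Q T) {D D' : Database Q Dom} {r : I}
    (h : ∀ i, i ≠ r → D i = D' i) {e : T} (he : ¬ e ≤ F.node r) :
    F.semi D e ⊆ F.semi D' e := by
  induction e using (wellFounded_gt (α := T)).induction with
  | _ e ih =>
    intro u hu
    rw [semi] at hu ⊢
    refine ⟨?_, fun c hc => ?_⟩
    · rintro i rfl
      rw [← h i (by rintro rfl; exact he le_rfl)]
      exact hu.1 i rfl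
    · obtain ⟨w, hw, h'⟩ := hu.2 c hc
      exact ⟨w, ih c hc.lt (fun hle => he (hc.lt.le.trans hle)) hw, h'⟩

end FreeConnexTree

namespace Update

variable {V I : Type*} {Q : CQ V I} {Dom : Type*}

/-- The smaller of the databases before and after the update. -/
noncomputable def lowDB (U : Update Q Dom) (D : Database Q Dom) : Database Q Dom :=
  match U.kind with
  | .ins => D
  | .del => U.minus D

theorem delta_eq {α : Type*} (U : Update Q Dom) (X : Database Q Dom → Set α)
    (D : Database Q Dom) : U.delta X D = X (U.enumDB D) \ X (U.lowDB D) := by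
  unfold delta enumDB lowDB
  cases U.kind <;> rfl

theorem eq_lowDB_or_eq_enumDB (U : Update Q Dom) (D : Database Q Dom) :
    D = U.lowDB D ∨ D = U.enumDB D := by
  unfold enumDB lowDB
  cases U.kind
  · exact Or.inl rfl
  · exact Or.inr rfl

theorem enumDB_eq_lowDB_of_ne (U : Update Q Dom) (D : Database Q Dom) {i : I} (h : i ≠ U.rel) :
    U.enumDB D i = U.lowDB D i := by
  classical
  unfold enumDB lowDB plus minus
  cases U.kind
  · exact Function.update_of_ne h _ _
  · exact (Function.update_of_ne h _ _).symm

theorem lowDB_subset_enumDB (U : Update Q Dom) (D : Database Q Dom) (i : I) :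
    U.lowDB D i ⊆ U.enumDB D i := by
  by_cases h : i = U.rel
  · subst h
    unfold enumDB lowDB plus minus
    cases U.kind <;> simp [Finset.erase_subset, Finset.subset_insert]
  · rw [U.enumDB_eq_lowDB_of_ne D h]

end Update

namespace FreeConnexTree

open RootedTree

variable {V I : Type*} {Q : CQ V I} {T : RootedTree} {Dom : Type*} [Finite T]

theorem osemi_mono (F : FreeConnexTree Q T) (D : Database Q Dom) (U : Update Q Dom) (e : T) :
    F.osemi (U.lowDB D) e ⊆ F.osemi (U.enumDB D) e :=
  Set.image_mono (F.semi_mono (U.lowDB_subset_enumDB D) e)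

theorem osemi_of_not_le (F : FreeConnexTree Q T) (D : Database Q Dom) (U : Update Q Dom) {e : T}
    (he : ¬ e ≤ F.node U.rel) : F.osemi (U.enumDB D) e ⊆ F.osemi (U.lowDB D) e :=
  Set.image_mono (F.semi_subset_of_not_le (fun _ h => U.enumDB_eq_lowDB_of_ne D h) he)

theorem live_subset_osemi (F : FreeConnexTree Q T) (D : Database Q Dom) (U : Update Q Dom) (e : T) :
    F.live D e ⊆ F.osemi (U.enumDB D) e := by
  rintro _ ⟨q, hq, rfl⟩
  have h := F.mem_osemi_of_mem_eval hq e
  rcases U.eq_lowDB_or_eq_enumDB D with hD | hD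
  · rw [hD] at h
    exact F.osemi_mono D U e h
  · rwa [← hD]

theorem keyAt_mem_pview (F : FreeConnexTree Q T) {D : Database Q Dom} {e : T} (he : e ∈ F.con)
    {q : Tup Dom Q.out} (h : F.atNode q e ∈ F.osemi D e) : F.keyAt he q ∈ F.pview D e := by
  obtain ⟨v, hv, h⟩ := h
  refine ⟨v, hv, funext fun x => ?_⟩
  exact congrFun h ⟨x.1, F.key_subset_oattr he x.2⟩

theorem keyAt_mem_pview_of_pred (F : FreeConnexTree Q T) {D : Database Q Dom} {e : T}
    (he : e ∈ F.con) (hb : e ≠ ⊥) {q : Tup Dom Q.out}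
    (h : F.atNode q (Order.pred e) ∈ F.osemi D (Order.pred e)) : F.keyAt he q ∈ F.pview D e := by
  obtain ⟨v, hv, h⟩ := h
  obtain ⟨w, hw, h'⟩ := F.exists_semi_child hb hv
  refine ⟨w, hw, funext fun x => ?_⟩
  have hx := (F.mem_key hb).mp x.2
  exact (h' x.1 hx.1 hx.2).trans (congrFun h ⟨x.1, F.key_subset_oattr_parent he x.2⟩)

/-- Where the projection view of a node `e` on the path from the updated relation to the root
does not change, the change is not propagated to the parent of `e`: the other children of the
parent are not on this path. -/
theorem pred_mem_osemi_lowDB (F : FreeConnexTree Q T) (D : Database Q Dom) (U : Update Q Dom)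
    {e : T} (he : e ∈ F.con) (hb : e ≠ ⊥) (hle : e ≤ F.node U.rel) {q : Tup Dom Q.out}
    (hq : F.atNode q (Order.pred e) ∈ F.osemi (U.enumDB D) (Order.pred e))
    (hk : F.keyAt he q ∈ F.pview (U.lowDB D) e) :
    F.atNode q (Order.pred e) ∈ F.osemi (U.lowDB D) (Order.pred e) := by
  obtain ⟨v, hv, hvq⟩ := hq
  refine ⟨v, ?_, hvq⟩
  rw [semi] at hv ⊢
  refine ⟨fun i hi => ?_, fun c hc => ?_⟩
  · rw [← U.enumDB_eq_lowDB_of_ne D]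
    · exact hv.1 i hi
    · rintro rfl
      rw [hi] at hle
      exact absurd (pred_lt_of_ne_bot hb) hle.not_gt
  · by_cases hce : c = e
    · subst hce
      obtain ⟨w, hw, h⟩ := hk
      refine ⟨w, hw, h.trans (funext fun x => ?_)⟩
      exact (congrFun hvq ⟨x.1, F.key_subset_oattr_parent he x.2⟩).symm
    · obtain ⟨w, hw, h⟩ := hv.2 c hc
      refine ⟨w, F.semi_subset_of_not_le (fun _ h => U.enumDB_eq_lowDB_of_ne D h) ?_ hw, h⟩
      exact fun hc' => hce (eq_of_isChild_of_le hc ⟨hb, rfl⟩ hc' hle)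

/-- Above a node where the propagation of the change stops, nothing changes. -/
theorem mem_osemi_lowDB_of_lt (F : FreeConnexTree Q T) (D : Database Q Dom) (U : Update Q Dom)
    {q : Tup Dom Q.out} (hq : q ∈ Q.eval (U.enumDB D)) {e : T} (he : e ∈ F.con)
    (hle : e ≤ F.node U.rel) (hk : F.keyAt he q ∈ F.pview (U.lowDB D) e) {f : T} (hf : f < e) :
    F.atNode q f ∈ F.osemi (U.lowDB D) f := by
  induction e using (wellFounded_lt (α := T)).induction with
  | _ e ih =>
    have hp := F.pred_mem_osemi_lowDB D U he hf.ne_bot hle (F.mem_osemi_of_mem_eval hq _) hk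
    rcases (Order.le_pred_of_lt hf).eq_or_lt with rfl | hlt
    · exact hp
    · have hlt' := pred_lt_of_ne_bot hf.ne_bot
      have hpc := F.con_of_le he hlt'.le
      exact ih _ hlt' hpc (hlt'.le.trans hle) (F.keyAt_mem_pview hpc hp) hlt

/-! ### The decomposition of the delta by the witnesses -/

/-- `e` is the highest node at which the semi-join view gains the projection of `q`. -/
def IsTop (F : FreeConnexTree Q T) (D : Database Q Dom) (U : Update Q Dom) (q : Tup Dom Q.out)
    (e : T) : Prop :=
  e ∈ F.con ∧ F.atNode q e ∉ F.osemi (U.lowDB D) e ∧ ∀ f < e, F.atNode q f ∈ F.osemi (U.lowDB D) f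

theorem le_node_of_notMem (F : FreeConnexTree Q T) (D : Database Q Dom)
    (U : Update Q Dom) {q : Tup Dom Q.out} (hq : q ∈ Q.eval (U.enumDB D)) {e : T}
    (h : F.atNode q e ∉ F.osemi (U.lowDB D) e) : e ≤ F.node U.rel := by
  by_contra hle
  exact h (F.osemi_of_not_le D U hle (F.mem_osemi_of_mem_eval hq e))

/-- Above its top node, `q` agrees with a live tuple before the update. For an insertion, `q` lies
in the old semi-join views on the whole connex subtree except at and below its top node, so there is an
old result that agrees with `q` there. -/
theorem IsTop.atNode_mem_live {F : FreeConnexTree Q T} {D : Database Q Dom} {U : Update Q Dom}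
    {q : Tup Dom Q.out} {e : T} (h : F.IsTop D U q e) (hq : q ∈ Q.eval (U.enumDB D)) {f : T}
    (hf : f < e) : F.atNode q f ∈ F.live D f := by
  rcases U.eq_lowDB_or_eq_enumDB D with hD | hD
  · obtain ⟨he, hne, habove⟩ := h
    have hle := F.le_node_of_notMem D U hq hne
    obtain ⟨q', hq', hqq⟩ := F.exists_eval_agree (U.lowDB D) q (F.con ∩ {f | ¬ e ≤ f})
      Set.inter_subset_left ⟨F.con_root, fun h => hf.ne_bot (le_bot_iff.mp h)⟩
      (fun a b hba ha => ⟨F.con_of_le ha.1 hba, fun h => ha.2 (h.trans hba)⟩)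
      (fun g hg => by
        by_cases hgn : g ≤ F.node U.rel
        · exact habove g ((le_total_of_le_of_le hgn hle).elim
            (fun h => lt_of_le_of_ne h (fun h' => hg.2 h'.ge)) (absurd · hg.2))
        · exact F.osemi_of_not_le D U hgn (F.mem_osemi_of_mem_eval hq g))
    rw [← hD] at hq'
    exact ⟨q', hq', hqq f ⟨F.con_of_le he hf.le, hf.not_ge⟩⟩
  · rw [← hD] at hq
    exact ⟨q, hq, rfl⟩

theorem IsTop.unique {F : FreeConnexTree Q T} {D : Database Q Dom} {U : Update Q Dom}
    {q : Tup Dom Q.out} (hq : q ∈ Q.eval (U.enumDB D)) {e f : T} (he : F.IsTop D U q e)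
    (hf : F.IsTop D U q f) : e = f := by
  have key : ∀ {a b : T}, F.IsTop D U q a → F.IsTop D U q b → a ≤ b → a = b := by
    intro a b ha hb hab
    by_contra hne
    exact ha.2.1 (hb.2.2 a (lt_of_le_of_ne hab hne))
  rcases le_total_of_le_of_le (F.le_node_of_notMem D U hq he.2.1)
    (F.le_node_of_notMem D U hq hf.2.1) with h | h
  · exact key he hf h
  · exact (key hf he h).symm

/-- For a query result `q`, the witness condition says that `e` is the top node of `q`. The
condition on the live view of the parent holds automatically. -/
theorem isWitness_atNode_iff (F : FreeConnexTree Q T) {D : Database Q Dom} {U : Update Q Dom}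
    {q : Tup Dom Q.out} (hq : q ∈ Q.eval (U.enumDB D)) {e : T} :
    F.IsWitness D U e (F.atNode q e) ↔ F.IsTop D U q e := by
  unfold IsWitness
  simp only [Update.delta_eq]
  constructor
  · rintro ⟨he, ⟨h1, h2⟩, h3⟩
    refine ⟨he, h2, fun f hf => ?_⟩
    refine F.mem_osemi_lowDB_of_lt D U hq he (F.le_node_of_notMem D U hq h2) ?_ hf
    have h4 := (h3 hf.ne_bot).1
    by_contra h5
    exact h4 ⟨F.keyAt_mem_pview he h1, h5⟩
  · intro h
    refine ⟨h.1, ⟨F.mem_osemi_of_mem_eval hq e, h.2.1⟩, fun hb => ⟨fun h' => h'.2 ?_, ?_⟩⟩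
    · exact F.keyAt_mem_pview_of_pred h.1 hb (h.2.2 _ (pred_lt_of_ne_bot hb))
    · exact ⟨_, h.atNode_mem_live hq (pred_lt_of_ne_bot hb), rfl⟩

theorem exists_isTop (F : FreeConnexTree Q T) {D : Database Q Dom} {U : Update Q Dom}
    {q : Tup Dom Q.out} (h' : q ∉ Q.eval (U.lowDB D)) :
    ∃ e, F.IsTop D U q e := by
  rw [F.mem_eval_iff] at h'
  push Not at h'
  obtain ⟨e, ⟨he, hne⟩, hmin⟩ := (wellFounded_lt (α := T)).has_min
    {f | f ∈ F.con ∧ F.atNode q f ∉ F.osemi (U.lowDB D) f} h'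
  refine ⟨e, he, hne, fun f hf => ?_⟩
  by_contra hn
  exact hmin f ⟨F.con_of_le he hf.le, hn⟩ hf

theorem delta_eval_eq_iUnion (F : FreeConnexTree Q T) (D : Database Q Dom) (U : Update Q Dom) :
    U.delta Q.eval D = ⋃ w ∈ {w : Σ e : T, Tup Dom (F.oattr e) | F.IsWitness D U w.1 w.2},
      F.witnessed (U.enumDB D) w.1 w.2 := by
  ext q
  rw [Update.delta_eq]
  simp only [Set.mem_iUnion, Set.mem_ofPred_eq, exists_prop, mem_witnessed_iff]
  constructor
  · rintro ⟨h, h'⟩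
    obtain ⟨e, he⟩ := F.exists_isTop h'
    exact ⟨⟨e, F.atNode q e⟩, (F.isWitness_atNode_iff h).mpr he, h, rfl⟩
  · rintro ⟨⟨e, t'⟩, hw, h, ht⟩
    obtain rfl : F.atNode q e = t' := ht
    have htop := (F.isWitness_atNode_iff h).mp hw
    exact ⟨h, fun hlow => htop.2.1 (F.mem_osemi_of_mem_eval hlow e)⟩

theorem pairwiseDisjoint_witnessed (F : FreeConnexTree Q T) (D : Database Q Dom)
    (U : Update Q Dom) :
    {w : Σ e : T, Tup Dom (F.oattr e) | F.IsWitness D U w.1 w.2}.PairwiseDisjoint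
      (fun w => F.witnessed (U.enumDB D) w.1 w.2) := by
  rintro ⟨e, t⟩ hw ⟨e', t'⟩ hw' hne
  refine Set.disjoint_left.mpr fun q h h' => hne ?_
  obtain ⟨hq, ht⟩ := F.mem_witnessed_iff.mp h
  obtain rfl : F.atNode q e = t := ht
  obtain rfl : F.atNode q e' = t' := (F.mem_witnessed_iff.mp h').2
  obtain rfl := IsTop.unique hq ((F.isWitness_atNode_iff hq).mp hw)
    ((F.isWitness_atNode_iff hq).mp hw')
  rfl

end FreeConnexTree

namespace FreeConnexTree

/-! ### Delay of nested loops -/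

variable {V I : Type*} {Q : CQ V I} {T : RootedTree} {Dom : Type*} {F : FreeConnexTree Q T}

/-- A refinement of `EnumeratesWithDelay S c` with a separate bound `m` for the number of steps up
to the first output, or up to the halt if there is no output. -/
inductive EnumeratesFrom (S : F.Store Dom) (c m : ℕ) : F.Config Dom → List (Tup Dom Q.out) → Prop
  | halt {n K} : n ≤ m → SilentSteps S n K [] → EnumeratesFrom S c m K []
  | output {n K K' K'' q qs} : n + 1 ≤ m → SilentSteps S n K K' →
      step S K' = (K'', some (fun x => some (q x))) → EnumeratesWithDelay S c K'' qs →
      EnumeratesFrom S c m K (q :: qs)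

namespace EnumeratesFrom

variable {S : F.Store Dom} {c m : ℕ} {K K₁ : F.Config Dom} {l : List (Tup Dom Q.out)}

theorem enumeratesWithDelay (h : EnumeratesFrom S c m K l) (hm : m ≤ c) :
    EnumeratesWithDelay S c K l := by
  cases h with
  | halt hn hs => exact .halt (hn.trans hm) hs
  | output hn hs hq hr => exact .output (hn.trans hm) hs hq hr

theorem mono (h : EnumeratesFrom S c m K l) {m' : ℕ} (hm : m ≤ m') :
    EnumeratesFrom S c m' K l := by
  cases h with
  | halt hn hs => exact .halt (hn.trans hm) hs
  | output hn hs hq hr => exact .output (hn.trans hm) hs hq hr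

theorem cons (h : EnumeratesFrom S c m K₁ l) (hs : step S K = (K₁, none)) :
    EnumeratesFrom S c (m + 1) K l := by
  cases h with
  | halt hn hs' => exact .halt (Nat.succ_le_succ hn) (.cons hs hs')
  | output hn hs' hq hr => exact .output (Nat.succ_le_succ hn) (.cons hs hs') hq hr

end EnumeratesFrom

end FreeConnexTree

namespace Prog

/-- The nesting depth of the index loops of a program. -/
def depth {T : RootedTree} : Prog T → ℕ
  | emit => 0
  | probe _ body => body.depth + 1
  | forWitness _ => 0

end Prog

namespace FreeConnexTree

variable {V I : Type*} {Q : CQ V I} {T : RootedTree} {Dom : Type*} {F : FreeConnexTree Q T}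

/-- `Yields S p ρ qs`: started with the registers `ρ`, the loop nest `p` outputs the tuples `qs`,
and none of its index lookups finds an empty bucket. -/
inductive Yields (S : F.Store Dom) : Prog T → Regs V Dom → List (Tup Dom Q.out) → Prop
  | emit {ρ q} : (∀ x : {x // x ∈ Q.out}, ρ x.1 = some (q x)) → Yields S .emit ρ [q]
  | probe {ix body ρ} (f : Tup Dom (F.ixCols ix) → List (Tup Dom Q.out)) :
      S.bucket ix (fun x => ρ x.1) ≠ [] →
      (∀ u ∈ S.bucket ix (fun x => ρ x.1), Yields S body (load u ρ) (f u)) →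
      Yields S (.probe ix body) ρ ((S.bucket ix (fun x => ρ x.1)).flatMap f)

/-- A loop nest of depth `d` without empty buckets needs at most `2 d + 1` steps to its first
output. Between two outputs it leaves at most `d` exhausted loops, advances one cursor, and descends
again. -/
theorem Yields.enumeratesFrom {S : F.Store Dom} {c : ℕ} {p : Prog T} {ρ : Regs V Dom}
    {qs : List (Tup Dom Q.out)} (h : Yields S p ρ qs) (hc : 3 * p.depth + 1 ≤ c) :
    ∀ {m : ℕ} {K : F.Config Dom} {l : List (Tup Dom Q.out)}, m + p.depth ≤ c →
      EnumeratesFrom S c m K l →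
      EnumeratesFrom S c (2 * p.depth + 1) (.run p ρ :: K) (qs ++ l) := by
  induction h with
  | emit hq =>
    intro m K l hm hK
    refine .output (n := 0) (by simp) (.refl _) ?_ (hK.enumeratesWithDelay (by omega))
    simp [step, hq]
  | @probe ix body ρ f hne _ ih =>
    intro m K l hm hK
    simp only [Prog.depth] at hc hm ⊢
    -- An exhausted loop costs one step before the `m` steps of the rest of the stack. Otherwise one
    -- step advances the cursor and the body needs at most `2 * body.depth + 1` steps.
    have scan : ∀ us : List (Tup Dom (F.ixCols ix)),
        (∀ u ∈ us, u ∈ S.bucket ix (fun x => ρ x.1)) →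
        EnumeratesFrom S c (if us = [] then m + 1 else 2 * body.depth + 2)
          (.scan ix us body ρ :: K) (us.flatMap f ++ l) := by
      intro us
      induction us with
      | nil => exact fun _ => hK.cons rfl
      | cons u us ih' =>
        intro hmem
        have h1 := ih' (fun v hv => hmem v (List.mem_cons_of_mem _ hv))
        have h2 := ih u (hmem u List.mem_cons_self) (by omega) (by split_ifs <;> omega) h1
        rw [List.flatMap_cons, List.append_assoc, if_neg (List.cons_ne_nil _ _)]
        exact h2.cons rfl
    have h1 := scan _ (fun _ h => h)
    rw [if_neg hne] at h1
    exact (h1.cons rfl).mono (by omega)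

/-- The outermost loop, over the witnesses. -/
theorem enumeratesFrom_scanW {S : F.Store Dom} {c d : ℕ} {body : T → Prog T}
    (hd : ∀ e, (body e).depth ≤ d) (hc : 3 * d + 2 ≤ c) {ρ : Regs V Dom}
    (f : (Σ e : T, Tup Dom (F.oattr e)) → List (Tup Dom Q.out))
    (ws : List (Σ e : T, Tup Dom (F.oattr e)))
    (hf : ∀ w ∈ ws, Yields S (body w.1) (load w.2 ρ) (f w)) :
    EnumeratesFrom S c (2 * d + 2) [.scanW ws body ρ] (ws.flatMap f) := by
  induction ws with
  | nil => exact .halt (by omega) (.cons rfl (.refl _))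
  | cons w ws ih =>
    have h1 := ih (fun v hv => hf v (List.mem_cons_of_mem _ hv))
    have hdw := hd w.1
    have h2 := (hf w List.mem_cons_self).enumeratesFrom (by omega) (by omega) h1
    rw [List.flatMap_cons]
    exact (h2.cons rfl).mono (by omega)

end FreeConnexTree

namespace FreeConnexTree

open RootedTree

variable {V I : Type*} {Q : CQ V I} {T : RootedTree} {Dom : Type*} {F : FreeConnexTree Q T}

/-! ### The order in which the programs visit the nodes -/

/-- `Plan F A p`: a nest of index loops that, with tuples at the nodes of `A` in the registers,
loads in each loop the tuple of one further node of the connex subtree, either of the parent of the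
lowest common ancestor of `A`, or of a new child of a node of `A`, until it has all of them. -/
inductive Plan (F : FreeConnexTree Q T) : Set T → Prog T → Prop
  | emit {A} : A = F.con → Plan F A .emit
  | live {A c body} : c ∈ F.con → c ≠ ⊥ → c ∈ A → (∀ f ∈ A, c ≤ f) →
      Plan F (insert (Order.pred c) A) body → Plan F A (.probe (.ofLive c) body)
  | semi {A c body} : c ∈ F.con → c ≠ ⊥ → Order.pred c ∈ A → (∀ f ∈ A, ¬ c ≤ f) →
      Plan F (insert c A) body → Plan F A (.probe (.ofSemi c) body)

variable [Finite T]

theorem mem_children {e : T} (c : {c : T // IsChild c e}) : c ∈ children e := by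
  simp [children]

theorem nodup_children (e : T) : (children e).Nodup := Finset.nodup_toList _

/-- Nested loops over a list of children, provided that `FullEnum` follows a plan at each of
them. -/
theorem Plan.foldr_fullEnum {e : T} {body : Prog T}
    (ih : ∀ c, IsChild c e → ∀ (A : Set T) (p : Prog T), e ∈ A → (∀ f ∈ A, ¬ c ≤ f) →
      Plan F (A ∪ (F.con ∩ Set.Ici c)) p → Plan F A (F.fullEnum c p))
    (l : List {c : T // IsChild c e}) (hl : l.Nodup) (A : Set T) (he : e ∈ A)
    (hA : ∀ c ∈ l, ∀ f ∈ A, ¬ c.1 ≤ f)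
    (h : Plan F (A ∪ {f | f ∈ F.con ∧ ∃ c ∈ l, c.1 ≤ f}) body) :
    Plan F A (l.foldr (fun c p => F.fullEnum c.1 p) body) := by
  induction l generalizing A with
  | nil => simpa using h
  | cons c l ihl =>
    rw [List.nodup_cons] at hl
    refine ih c.1 c.2 A _ he (hA c List.mem_cons_self) (ihl hl.2 _ (Or.inl he) ?_ ?_)
    · rintro c' hc' f (hf | ⟨-, hf⟩) hle
      · exact hA c' (List.mem_cons_of_mem _ hc') f hf hle
      · have := eq_of_isChild_of_le c'.2 c.2 hle hf
        exact hl.1 (Subtype.ext this ▸ hc')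
    · convert h using 1
      ext f
      simp only [Set.mem_union, Set.mem_inter_iff, Set.mem_Ici, Set.mem_ofPred_eq,
        List.mem_cons, exists_eq_or_imp]
      tauto

/-- `FullEnum` on `T_e` loads the nodes of the connex subtree below `e`. -/
theorem Plan.fullEnum {e : T} (hb : e ≠ ⊥) (A : Set T) (body : Prog T)
    (hp : Order.pred e ∈ A) (hA : ∀ f ∈ A, ¬ e ≤ f)
    (h : Plan F (A ∪ (F.con ∩ Set.Ici e)) body) : Plan F A (F.fullEnum e body) := by
  induction e using (wellFounded_gt (α := T)).induction generalizing A body with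
  | _ e ih =>
    rw [FreeConnexTree.fullEnum]
    split_ifs with he
    · refine .semi he hb hp hA (Plan.foldr_fullEnum ?_ _ (nodup_children e) _
        (Set.mem_insert _ _) ?_ ?_)
      · intro c hc A' p heA' hcA' h'
        exact ih c hc.lt hc.1 A' p (hc.2.symm ▸ heA') hcA' h'
      · rintro c - f (rfl | hf) hle
        · exact hle.not_gt c.2.lt
        · exact hA f hf (c.2.lt.le.trans hle)
      · convert h using 1
        ext f
        simp only [Set.mem_union, Set.mem_insert_iff, Set.mem_inter_iff, Set.mem_Ici,
          Set.mem_ofPred_eq]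
        constructor
        · rintro ((rfl | hf) | ⟨hf, c, -, hle⟩)
          · exact Or.inr ⟨he, le_rfl⟩
          · exact Or.inl hf
          · exact Or.inr ⟨hf, c.2.lt.le.trans hle⟩
        · rintro (hf | ⟨hf, hle⟩)
          · exact Or.inl (Or.inr hf)
          · rcases hle.eq_or_lt with rfl | hlt
            · exact Or.inl (Or.inl rfl)
            · obtain ⟨c, hc, hcf⟩ := exists_isChild_le hlt
              exact Or.inr ⟨hf, ⟨c, hc⟩, mem_children _, hcf⟩
    · convert h using 1
      ext f
      simp only [Set.mem_union, Set.mem_inter_iff, Set.mem_Ici]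
      exact ⟨Or.inl, fun h => h.elim id fun h' => absurd (F.con_of_le h'.1 h'.2) he⟩

theorem Plan.foldr_children {e : T} {body : Prog T} (l : List {c : T // IsChild c e})
    (hl : l.Nodup) (A : Set T) (he : e ∈ A) (hA : ∀ c ∈ l, ∀ f ∈ A, ¬ c.1 ≤ f)
    (h : Plan F (A ∪ {f | f ∈ F.con ∧ ∃ c ∈ l, c.1 ≤ f}) body) :
    Plan F A (l.foldr (fun c p => F.fullEnum c.1 p) body) :=
  Plan.foldr_fullEnum (fun _ hc A p he hA h => Plan.fullEnum hc.1 A p (hc.2.symm ▸ he) hA h)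
    l hl A he hA h

theorem Plan.climb {e : T} (he : e ∈ F.con) (A : Set T) (body : Prog T) (heA : e ∈ A)
    (hA : ∀ f ∈ A, e ≤ f) (h : Plan F (A ∪ Set.Iic e) body) :
    Plan F A (FreeConnexTree.climb e body) := by
  induction e using (wellFounded_lt (α := T)).induction generalizing A with
  | _ e ih =>
    rw [FreeConnexTree.climb]
    split_ifs with hb
    · convert h using 1
      subst hb
      simp [heA]
    · have hlt := pred_lt_of_ne_bot hb
      refine .live he hb heA hA (ih _ hlt (F.con_of_le he hlt.le) _ (Set.mem_insert _ _) ?_ ?_)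
      · rintro f (rfl | hf)
        · exact le_rfl
        · exact hlt.le.trans (hA f hf)
      · convert h using 1
        ext f
        simp only [Set.mem_union, Set.mem_insert_iff, Set.mem_Iic]
        constructor
        · rintro ((rfl | hf) | hf)
          · exact Or.inr hlt.le
          · exact Or.inl hf
          · exact Or.inr (hf.trans hlt.le)
        · rintro (hf | hf)
          · exact Or.inl (Or.inr hf)
          · rcases hf.eq_or_lt with rfl | hf
            · exact Or.inl (Or.inr heA)
            · exact Or.inr (Order.le_pred_of_lt hf)

theorem Plan.enumAbove {e : T} (he : e ∈ F.con) :
    Plan F (Set.Iic e ∪ (F.con ∩ Set.Ici e)) (F.enumAbove e .emit) := by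
  induction e using (wellFounded_lt (α := T)).induction with
  | _ e ih =>
    rw [FreeConnexTree.enumAbove]
    split_ifs with hb
    · subst hb
      refine .emit ?_
      simp [F.con_root]
    · have hlt := pred_lt_of_ne_bot hb
      have hpe : IsChild e (Order.pred e) := ⟨hb, rfl⟩
      refine Plan.foldr_children _ ((nodup_children _).filter _) _ (Or.inl hlt.le) ?_ ?_
      · rintro c hc f hf hle
        have hne : c.1 ≠ e := by simpa using (List.mem_filter.mp hc).2
        rcases hf with hf | ⟨-, hf⟩
        · exact hne (eq_of_isChild_of_le c.2 hpe (hle.trans hf) le_rfl)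
        · exact hne (eq_of_isChild_of_le c.2 hpe hle hf)
      · convert ih _ hlt (F.con_of_le he hlt.le) using 1
        ext f
        simp only [Set.mem_union, Set.mem_inter_iff, Set.mem_Iic, Set.mem_Ici, Set.mem_ofPred_eq,
          List.mem_filter, mem_children, true_and, decide_eq_true_eq]
        constructor
        · rintro ((hf | ⟨hf, hle⟩) | ⟨hf, c, -, hle⟩)
          · rcases hf.eq_or_lt with rfl | hf
            · exact Or.inr ⟨he, hlt.le⟩
            · exact Or.inl (Order.le_pred_of_lt hf)
          · exact Or.inr ⟨hf, hlt.le.trans hle⟩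
          · exact Or.inr ⟨hf, c.2.lt.le.trans hle⟩
        · rintro (hf | ⟨hf, hle⟩)
          · exact Or.inl (Or.inl (hf.trans hlt.le))
          · rcases hle.eq_or_lt with rfl | hlt'
            · exact Or.inl (Or.inl hlt.le)
            · obtain ⟨c, hc, hcf⟩ := exists_isChild_le hlt'
              by_cases hce : c = e
              · exact Or.inl (Or.inr ⟨hf, hce ▸ hcf⟩)
              · exact Or.inr ⟨hf, ⟨c, hc⟩, hce, hcf⟩

/-- The loop nest that `DeltaEnum` runs for a witness at the node `e`. -/
noncomputable def witnessBody (F : FreeConnexTree Q T) (e : T) : Prog T :=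
  climb e ((children e).foldr (fun c p => F.fullEnum c.1 p) (F.enumAbove e .emit))

theorem plan_witnessBody {e : T} (he : e ∈ F.con) : Plan F {e} (F.witnessBody e) := by
  refine Plan.climb he _ _ rfl (fun f hf => le_of_eq hf.symm)
    (Plan.foldr_children _ (nodup_children e) _ (Or.inl rfl) ?_ ?_)
  · rintro c - f (rfl | hf) hle
    · exact hle.not_gt c.2.lt
    · exact (hle.trans hf).not_gt c.2.lt
  · convert Plan.enumAbove he using 1
    ext f
    simp only [Set.mem_union, Set.mem_singleton_iff, Set.mem_inter_iff, Set.mem_Iic, Set.mem_Ici,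
      Set.mem_ofPred_eq, mem_children, true_and]
    constructor
    · rintro ((rfl | hf) | ⟨hf, c, hle⟩)
      · exact Or.inl le_rfl
      · exact Or.inl hf
      · exact Or.inr ⟨hf, c.2.lt.le.trans hle⟩
    · rintro (hf | ⟨hf, hle⟩)
      · exact Or.inl (Or.inr hf)
      · rcases hle.eq_or_lt with rfl | hlt
        · exact Or.inl (Or.inl rfl)
        · obtain ⟨c, hc, hcf⟩ := exists_isChild_le hlt
          exact Or.inr ⟨hf, ⟨c, hc⟩, hcf⟩

/-! ### The outputs of the programs -/

theorem load_of_mem {s : Finset V} (u : Tup Dom s) (ρ : Regs V Dom) {x : V} (h : x ∈ s) :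
    load u ρ x = some (u ⟨x, h⟩) := by
  unfold load
  rw [dif_pos h]

theorem load_of_notMem {s : Finset V} (u : Tup Dom s) (ρ : Regs V Dom) {x : V} (h : x ∉ s) :
    load u ρ x = ρ x := by
  unfold load
  rw [dif_neg h]

/-- The nonempty registers of output attributes hold the values of `q`. -/
def Agrees (ρ : Regs V Dom) (q : Tup Dom Q.out) : Prop :=
  ∀ x : {x // x ∈ Q.out}, ρ x.1 ≠ none → ρ x.1 = some (q x)

/-- One index loop, provided that the loaded tuples overwrite only registers of the key. Different
tuples of the bucket lead to different outputs, as the output attributes include the loaded ones. -/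
theorem exists_yields_probe {D : Database Q Dom} {U : Update Q Dom} {S : F.Store Dom}
    (hS : S.Represents D U) {ix : Index T} (hcon : ixNode ix ∈ F.con) (hb : ixNode ix ≠ ⊥)
    (hcols : F.ixCols ix ⊆ Q.out) {ρ : Regs V Dom}
    (hsep : ∀ x ∈ F.ixCols ix, ρ x ≠ none → x ∈ F.ixKey ix)
    (hne : S.bucket ix (fun x => ρ x.1) ≠ []) {body : Prog T} {P : Tup Dom Q.out → Prop}
    (h : ∀ u ∈ S.bucket ix (fun x => ρ x.1), ∃ qs, Yields S body (load u ρ) qs ∧ qs.Nodup ∧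
      ∀ q, q ∈ qs ↔ Agrees (load u ρ) q ∧ P q) :
    ∃ qs, Yields S (.probe ix body) ρ qs ∧ qs.Nodup ∧
      ∀ q, q ∈ qs ↔ Agrees ρ q ∧ Tup.proj hcols q ∈ F.ixView D U ix ∧ P q := by
  choose! f hf hnd hmem using h
  have hproj : ∀ u ∈ S.bucket ix (fun x => ρ x.1), ∀ q ∈ f u, Tup.proj hcols q = u := by
    intro u hu q hq
    funext x
    have h1 := ((hmem u hu q).mp hq).1 ⟨x.1, hcols x.2⟩
    rw [load_of_mem u ρ x.2] at h1
    exact (Option.some.inj (h1 (Option.some_ne_none _))).symm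
  refine ⟨_, .probe f hne hf, List.nodup_flatMap.mpr ⟨hnd, ?_⟩, fun q => ?_⟩
  · refine (hS.bucket_nodup ix hcon hb _).imp_of_mem fun {u v} hu hv huv => ?_
    intro q hq hq'
    exact huv ((hproj u hu q hq).symm.trans (hproj v hv q hq'))
  · rw [List.mem_flatMap]
    constructor
    · rintro ⟨u, hu, hq⟩
      obtain ⟨hview, hmatch⟩ := (hS.mem_bucket ix hcon hb _ u).mp hu
      obtain ⟨hag, hP⟩ := (hmem u hu q).mp hq
      refine ⟨fun x hx => ?_, (hproj u hu q hq).symm ▸ hview, hP⟩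
      by_cases hxc : x.1 ∈ F.ixCols ix
      · have h1 := hmatch x.1 (hsep _ hxc hx) hxc
        have h2 := congrFun (hproj u hu q hq) ⟨x.1, hxc⟩
        exact h1.trans (congrArg some h2.symm)
      · have h1 := hag x
        rw [load_of_notMem u ρ hxc] at h1
        exact h1 hx
    · rintro ⟨hag, hview, hP⟩
      have hu : Tup.proj hcols q ∈ S.bucket ix (fun x => ρ x.1) := by
        refine (hS.mem_bucket ix hcon hb _ _).mpr ⟨hview, fun x h₁ h₂ => ?_⟩
        obtain ⟨v, hv⟩ := List.exists_mem_of_ne_nil _ hne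
        have h1 : ρ x = _ := ((hS.mem_bucket ix hcon hb _ v).mp hv).2 x h₁ h₂
        exact hag ⟨x, hcols h₂⟩ (by rw [h1]; exact Option.some_ne_none _)
      refine ⟨_, hu, (hmem _ hu q).mpr ⟨fun x hx => ?_, hP⟩⟩
      by_cases hxc : x.1 ∈ F.ixCols ix
      · exact load_of_mem _ ρ hxc
      · rw [load_of_notMem _ ρ hxc] at hx ⊢
        exact hag x hx

/-- The invariant of the loops: the registers contain tuples of the semi-join views at the nodes of
`A`, and nothing else; at the lowest common ancestor of `A`, if it is a node of `A`, they join
with the live view of the parent. -/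
structure Loaded (F : FreeConnexTree Q T) (D : Database Q Dom) (U : Update Q Dom) (A : Set T)
    (ρ : Regs V Dom) : Prop where
  exists_mem : ∀ x, ρ x ≠ none → ∃ f ∈ A, x ∈ F.oattr f
  exists_osemi : ∀ f ∈ A, ∃ u ∈ F.osemi (U.enumDB D) f, ∀ x (h : x ∈ F.oattr f),
    ρ x = some (u ⟨x, h⟩)
  exists_live : ∀ c ∈ A, c ≠ ⊥ → (∀ f ∈ A, c ≤ f) → ∃ v ∈ F.live D (Order.pred c),
    ∀ x ∈ F.key c, ∀ h' : x ∈ F.oattr (Order.pred c), ρ x = some (v ⟨x, h'⟩)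

/-- Loading a tuple that agrees with the nonempty registers does not change these registers. -/
theorem load_eq_of_ne_none {s : Finset V} {u : Tup Dom s} {ρ : Regs V Dom}
    (h : ∀ x (hx : x ∈ s), ρ x ≠ none → ρ x = some (u ⟨x, hx⟩)) {x : V} (hx : ρ x ≠ none) :
    load u ρ x = ρ x := by
  by_cases hs : x ∈ s
  · rw [load_of_mem u ρ hs, h x hs hx]
  · exact load_of_notMem u ρ hs

theorem Loaded.load {D : Database Q Dom} {U : Update Q Dom} {A : Set T} {ρ : Regs V Dom}
    (h : F.Loaded D U A ρ) {f : T} {u : Tup Dom (F.oattr f)} (hu : u ∈ F.osemi (U.enumDB D) f)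
    (hag : ∀ x (hx : x ∈ F.oattr f), ρ x ≠ none → ρ x = some (u ⟨x, hx⟩))
    (hlive : ∀ c ∈ insert f A, c ≠ ⊥ → (∀ g ∈ insert f A, c ≤ g) → ∃ v ∈ F.live D (Order.pred c),
      ∀ x ∈ F.key c, ∀ h' : x ∈ F.oattr (Order.pred c), load u ρ x = some (v ⟨x, h'⟩)) :
    F.Loaded D U (insert f A) (load u ρ) where
  exists_mem x hx := by
    by_cases hs : x ∈ F.oattr f
    · exact ⟨f, Set.mem_insert _ _, hs⟩
    · rw [load_of_notMem u ρ hs] at hx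
      obtain ⟨g, hg, hxg⟩ := h.exists_mem x hx
      exact ⟨g, Set.mem_insert_of_mem _ hg, hxg⟩
  exists_osemi := by
    rintro g (rfl | hg)
    · exact ⟨u, hu, fun x hx => load_of_mem u ρ hx⟩
    · obtain ⟨v, hv, hvρ⟩ := h.exists_osemi g hg
      refine ⟨v, hv, fun x hx => ?_⟩
      rw [load_eq_of_ne_none hag, hvρ x hx]
      rw [hvρ x hx]
      exact Option.some_ne_none _
  exists_live := hlive

/-- The index loops of a plan output, without repetition, the results that agree with the registers
and that lie in the live views of all nodes above `A`. -/
theorem Plan.exists_yields {D : Database Q Dom} {U : Update Q Dom} {S : F.Store Dom}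
    (hS : S.Represents D U) {A : Set T} {p : Prog T} (hp : Plan F A p) {ρ : Regs V Dom}
    (hρ : F.Loaded D U A ρ) :
    ∃ qs, Yields S p ρ qs ∧ qs.Nodup ∧ ∀ q, q ∈ qs ↔ Agrees ρ q ∧
      q ∈ Q.eval (U.enumDB D) ∧ ∀ f, (∀ g ∈ A, f < g) → F.atNode q f ∈ F.live D f := by
  induction hp generalizing ρ with
  | @emit A hA =>
    subst hA
    have hval : ∀ x : {x // x ∈ Q.out}, ∃ a, ρ x.1 = some a := by
      intro x
      obtain ⟨f, hf, hx⟩ := F.con_out x.1 x.2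
      obtain ⟨u, -, hu⟩ := hρ.exists_osemi f hf
      exact ⟨_, hu x.1 (F.mem_oattr.mpr ⟨x.2, hx⟩)⟩
    choose q hq using hval
    refine ⟨[q], .emit hq, List.nodup_singleton q, fun q' => ?_⟩
    rw [List.mem_singleton]
    constructor
    · rintro rfl
      refine ⟨fun x _ => hq x, F.mem_eval_iff.mpr fun f hf => ?_,
        fun f hf => absurd (hf ⊥ F.con_root) not_lt_bot⟩
      obtain ⟨u, hu, huρ⟩ := hρ.exists_osemi f hf
      have : F.atNode q' f = u := funext fun x => Option.some.inj
        ((hq ⟨x.1, F.oattr_subset_out f x.2⟩).symm.trans (huρ x.1 x.2))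
      rwa [this]
    · rintro ⟨hag, -⟩
      funext x
      have h1 := hag x (by rw [hq x]; exact Option.some_ne_none _)
      exact Option.some.inj (h1.symm.trans (hq x))
  | @live A c body hc hb hcA hA _ ih =>
    have hlt := pred_lt_of_ne_bot hb
    have hpc := F.con_of_le hc hlt.le
    have hsep : ∀ x ∈ F.oattr (Order.pred c), ρ x ≠ none → x ∈ F.key c := by
      intro x hx hxρ
      obtain ⟨f, hf, hxf⟩ := hρ.exists_mem x hxρ
      have h1 := (F.mem_oattr.mp hx).2
      exact (F.mem_key hb).mpr ⟨F.connect x _ h1 f (F.mem_oattr.mp hxf).2 c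
        (inf_le_left.trans hlt.le) (Or.inr (hA f hf)), h1⟩
    obtain ⟨v, hv, hvρ⟩ := hρ.exists_live c hcA hb hA
    obtain ⟨qs, h1, h2, h3⟩ := exists_yields_probe hS (ix := .ofLive c) hc hb
      (F.oattr_subset_out _) hsep
      (List.ne_nil_of_mem ((hS.mem_bucket (.ofLive c) hc hb _ v).mpr
        ⟨hv, fun x h₁ h₂ => hvρ x h₁ h₂⟩))
      (fun u hu => by
        obtain ⟨huv, hmatch⟩ := (hS.mem_bucket (.ofLive c) hc hb _ u).mp hu
        refine ih (hρ.load (F.live_subset_osemi D U _ huv)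
          (fun x hx hxρ => hmatch x (hsep x hx hxρ) hx) ?_)
        intro g hg hgb hgA
        obtain rfl : g = Order.pred c := by
          rcases hg with rfl | hg
          · rfl
          · exact absurd ((hA g hg).trans (hgA _ (Set.mem_insert _ _))) hlt.not_ge
        obtain ⟨q₀, hq₀, hqu⟩ := huv
        refine ⟨F.atNode q₀ _, ⟨q₀, hq₀, rfl⟩, fun x hx h' => ?_⟩
        have hxo := F.key_subset_oattr hpc hx
        exact (load_of_mem u ρ hxo).trans (congrArg some (congrFun hqu ⟨x, hxo⟩).symm))
    refine ⟨qs, h1, h2, fun q => (h3 q).trans (and_congr_right fun _ => ?_)⟩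
    constructor
    · rintro ⟨hview, hq, hl⟩
      refine ⟨hq, fun f hf => ?_⟩
      rcases (Order.le_pred_of_lt (hf c hcA)).eq_or_lt with rfl | hlt'
      · exact hview
      · refine hl f ?_
        rintro g (rfl | hg)
        · exact hlt'
        · exact hf g hg
    · rintro ⟨hq, hl⟩
      exact ⟨hl _ fun g hg => hlt.trans_le (hA g hg), hq,
        fun f hf => hl f fun g hg => hf g (Set.mem_insert_of_mem _ hg)⟩
  | @semi A c body hc hb hpA hA _ ih =>
    have hlt := pred_lt_of_ne_bot hb
    have hsep : ∀ x ∈ F.oattr c, ρ x ≠ none → x ∈ F.key c := by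
      intro x hx hxρ
      obtain ⟨f, hf, hxf⟩ := hρ.exists_mem x hxρ
      have h1 := (F.mem_oattr.mp hx).2
      exact (F.mem_key hb).mpr
        ⟨h1, (F.connect x).pred_mem h1 (F.mem_oattr.mp hxf).2 (hA f hf)⟩
    obtain ⟨_, ⟨v, hv, rfl⟩, hvρ⟩ := hρ.exists_osemi _ hpA
    obtain ⟨w, hw, hwv⟩ := F.exists_semi_child hb hv
    obtain ⟨qs, h1, h2, h3⟩ := exists_yields_probe hS (ix := .ofSemi c) hc hb
      (F.oattr_subset_out _) hsep
      (List.ne_nil_of_mem ((hS.mem_bucket (.ofSemi c) hc hb _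
        (Tup.proj (F.oattr_subset_attr c) w)).mpr ⟨⟨w, hw, rfl⟩, fun x h₁ h₂ =>
          (hvρ x (F.key_subset_oattr_parent hc h₁)).trans (congrArg some (hwv x _ _).symm)⟩))
      (fun u hu => by
        obtain ⟨huv, hmatch⟩ := (hS.mem_bucket (.ofSemi c) hc hb _ u).mp hu
        have hag : ∀ x (hx : x ∈ F.oattr c), ρ x ≠ none → ρ x = some (u ⟨x, hx⟩) :=
          fun x hx hxρ => hmatch x (hsep x hx hxρ) hx
        refine ih (hρ.load huv hag ?_)
        -- The lowest common ancestor of the loaded nodes is still the same.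
        intro g hg hgb hgA
        have hgp := hgA _ (Set.mem_insert_of_mem _ hpA)
        have hgA' : g ∈ A := hg.resolve_left (hgp.trans_lt hlt).ne
        obtain ⟨v', hv', h⟩ := hρ.exists_live g hgA' hgb
          (fun f hf => hgA f (Set.mem_insert_of_mem _ hf))
        refine ⟨v', hv', fun x hx h' => ?_⟩
        rw [← h x hx h']
        exact load_eq_of_ne_none hag (by rw [h x hx h']; exact Option.some_ne_none _))
    refine ⟨qs, h1, h2, fun q => (h3 q).trans (and_congr_right fun _ => ?_)⟩
    constructor
    · rintro ⟨-, hq, hl⟩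
      refine ⟨hq, fun f hf => hl f ?_⟩
      rintro g (rfl | hg)
      · exact (hf _ hpA).trans hlt
      · exact hf g hg
    · rintro ⟨hq, hl⟩
      exact ⟨F.mem_osemi_of_mem_eval hq c, hq,
        fun f hf => hl f fun g hg => hf g (Set.mem_insert_of_mem _ hg)⟩

theorem IsWitness.loaded {D : Database Q Dom} {U : Update Q Dom} {e : T}
    {t' : Tup Dom (F.oattr e)} (h : F.IsWitness D U e t') :
    F.Loaded D U {e} (load t' fun _ => none) := by
  unfold IsWitness at h
  simp only [Update.delta_eq] at h
  obtain ⟨he, ⟨ht, -⟩, hlive⟩ := h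
  refine ⟨fun x hx => ⟨e, rfl, ?_⟩, ?_, ?_⟩
  · by_contra hxe
    exact hx (load_of_notMem t' _ hxe)
  · rintro f rfl
    exact ⟨t', ht, fun x hx => load_of_mem t' _ hx⟩
  · rintro c rfl hb -
    obtain ⟨v, hv, h⟩ := (hlive hb).2
    refine ⟨v, hv, fun x hx h' => ?_⟩
    rw [load_of_mem t' _ (F.key_subset_oattr he hx)]
    exact congrArg some (congrFun h ⟨x, hx⟩).symm

/-- The loop nest for a witness outputs the results that this witness contributes. Every such result
agrees above the witness with the live views before the update, so the join with these views misses
none of them. -/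
theorem exists_yields_witnessBody {D : Database Q Dom} {U : Update Q Dom} {S : F.Store Dom}
    (hS : S.Represents D U) {e : T} {t' : Tup Dom (F.oattr e)} (h : F.IsWitness D U e t') :
    ∃ qs, Yields S (F.witnessBody e) (load t' fun _ => none) qs ∧ qs.Nodup ∧
      ∀ q, q ∈ qs ↔ q ∈ F.witnessed (U.enumDB D) e t' := by
  obtain ⟨qs, h1, h2, h3⟩ := (plan_witnessBody h.fst).exists_yields hS h.loaded
  refine ⟨qs, h1, h2, fun q => (h3 q).trans ?_⟩
  rw [mem_witnessed_iff]
  constructor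
  · rintro ⟨hag, hq, -⟩
    refine ⟨hq, funext fun x => ?_⟩
    have h4 := hag ⟨x.1, F.oattr_subset_out e x.2⟩
    rw [load_of_mem t' _ x.2] at h4
    exact (Option.some.inj (h4 (Option.some_ne_none _))).symm
  · rintro ⟨hq, rfl⟩
    refine ⟨fun x hx => ?_, hq, fun f hf =>
      ((F.isWitness_atNode_iff hq).mp h).atNode_mem_live hq (hf e rfl)⟩
    by_cases hxe : x.1 ∈ F.oattr e
    · exact load_of_mem _ _ hxe
    · exact absurd (load_of_notMem _ _ hxe) hx

theorem exists_enumeratesWithDelay {D : Database Q Dom} {U : Update Q Dom} {S : F.Store Dom}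
    (hS : S.Represents D U) {d : ℕ} (hd : ∀ e, (F.witnessBody e).depth ≤ d) :
    ∃ outs : List (Tup Dom Q.out), outs.Nodup ∧ (∀ q, q ∈ outs ↔ q ∈ U.delta Q.eval D) ∧
      EnumeratesWithDelay S (3 * d + 3) (F.start Dom) outs := by
  have hw : ∀ w ∈ S.witnesses, F.IsWitness D U w.1 w.2 :=
    fun w h => (hS.mem_witnesses w.1 w.2).mp h
  have hbody : ∀ w ∈ S.witnesses, ∃ qs, Yields S (F.witnessBody w.1) (load w.2 fun _ => none) qs ∧
      qs.Nodup ∧ ∀ q, q ∈ qs ↔ q ∈ F.witnessed (U.enumDB D) w.1 w.2 :=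
    fun w h => exists_yields_witnessBody hS (hw w h)
  choose! f hf hnd hmem using hbody
  refine ⟨S.witnesses.flatMap f, List.nodup_flatMap.mpr ⟨hnd, ?_⟩, fun q => ?_, ?_⟩
  · refine hS.witnesses_nodup.imp_of_mem fun {w w'} h h' hne => ?_
    intro q hq hq'
    exact Set.disjoint_left.mp (F.pairwiseDisjoint_witnessed D U (hw w h) (hw w' h') hne)
      ((hmem w h q).mp hq) ((hmem w' h' q).mp hq')
  · rw [F.delta_eval_eq_iUnion, List.mem_flatMap]
    simp only [Set.mem_iUnion, Set.mem_ofPred_eq, exists_prop]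
    constructor
    · rintro ⟨w, h, hq⟩
      exact ⟨w, hw w h, (hmem w h q).mp hq⟩
    · rintro ⟨w, h, hq⟩
      have h' := (hS.mem_witnesses w.1 w.2).mpr h
      exact ⟨w, h', (hmem w h' q).mpr hq⟩
  · have h := enumeratesFrom_scanW hd (c := 3 * d + 3) (by omega) f _ hf
    exact (h.cons rfl).enumeratesWithDelay (by omega)

end FreeConnexTree

theorem mainTheorem2 {V I : Type*} (Q : CQ V I) (T : RootedTree) [Finite T]
    (F : FreeConnexTree Q T) :
    ∃ c : ℕ, ∀ (Dom : Type*) (D : Database Q Dom) (U : Update Q Dom),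
      (U.delta Q.eval D = ⋃ w ∈ {w : Σ e : T, Tup Dom (F.oattr e) | F.IsWitness D U w.1 w.2},
          F.witnessed (U.enumDB D) w.1 w.2) ∧
      {w : Σ e : T, Tup Dom (F.oattr e) | F.IsWitness D U w.1 w.2}.PairwiseDisjoint
        (fun w => F.witnessed (U.enumDB D) w.1 w.2) ∧
      ∀ S : F.Store Dom, S.Represents D U →
        ∃ outs : List (Tup Dom Q.out), outs.Nodup ∧
          (∀ q, q ∈ outs ↔ q ∈ U.delta Q.eval D) ∧
          FreeConnexTree.EnumeratesWithDelay S c (F.start Dom) outs := by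
  obtain ⟨d, hd⟩ := (Set.finite_range fun e => (F.witnessBody e).depth).bddAbove
  exact ⟨3 * d + 3, fun Dom D U => ⟨F.delta_eval_eq_iUnion D U, F.pairwiseDisjoint_witnessed D U,
    fun S hS => FreeConnexTree.exists_enumeratesWithDelay hS fun e => hd ⟨e, rfl⟩⟩⟩
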